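/- A tree is a partial order $(T,\preceq)$ with a least element such that for every $n \in T$ the set $\{m \in T : m \preceq n\}$ is finite and linearly ordered; it is computable if $T$ is a computable subset of $\omega$ and $\preceq$ is a computable relation. A node $m$ is a successor of $n$ if $n \prec m$ and no node lies strictly between them, and $T$ is binary branching if every node has at most two successors. A path is an infinite maximal linearly ordered subset of $T$, and a path $P$ is isolated if some $n \in P$ lies on no path other than $P$. A tree is of type 3 if it is infinite, has no isolated path, and has no node $n$ such that $\{m : n \preceq m\}$ is infinite while $\{k : m \preceq k\}$ is finite for every $m \succ n$. A self-embedding of $T$ is an injective function $\delta : T \to T$ such that $n \preceq m$ if and only if $\delta(n) \preceq \delta(m)$; it is nontrivial if it is not onto. Theorem. There is an infinite computable binary branching tree $S$ with no isolated paths (and hence of type 3) such that every nontrivial self-embedding $\delta$ of $S$ computes $0''$, the second Turing jump of the empty set, i.e. $0'' \leq_T \delta$. -/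

import Mathlib

namespace SelfEmb

/-! ## Trees -/

section Trees

variable {T : Type*} (r : T → T → Prop)

/-- `r` is a tree order on `T`: a partial order with a least element (the root) in which the set of
predecessors of each node is finite and linearly ordered. -/
structure IsTreeOrder : Prop where
  partialOrder : IsPartialOrder T r
  exists_root : ∃ root, ∀ n, r root n
  finite_below : ∀ n, {m | r m n}.Finite
  chain_below : ∀ n, IsChain r {m | r m n}

/-- `m` is a successor of `n`: `m` is strictly above `n` and nothing lies strictly between. -/
def IsSuccessor (n m : T) : Prop :=
  r n m ∧ n ≠ m ∧ ∀ k, r n k → r k m → k = n ∨ k = m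

/-- Every node has at most two successors. -/
def IsBinaryBranching : Prop :=
  ∀ n, {m | IsSuccessor r n m}.encard ≤ 2

/-- A path is an infinite maximal linearly ordered subset. -/
def IsPath (P : Set T) : Prop :=
  P.Infinite ∧ IsMaxChain r P

/-- A path is isolated if it contains a node through which it is the only path. -/
def IsIsolatedPath (P : Set T) : Prop :=
  IsPath r P ∧ ∃ n ∈ P, ∀ Q, IsPath r Q → n ∈ Q → Q = P

/-- `n` has infinitely many nodes above it, but each node strictly above `n` has only finitely
many. -/
def IsMaximalInfiniteNode (n : T) : Prop :=
  {m | r n m}.Infinite ∧ ∀ m, r n m → n ≠ m → {k | r m k}.Finite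

/-- Type 3: infinite, with no maximal infinite node and no isolated path. -/
structure IsType3 : Prop where
  infinite : Infinite T
  no_maximal_infinite_node : ∀ n, ¬ IsMaximalInfiniteNode r n
  no_isolated_path : ∀ P, ¬ IsIsolatedPath r P

end Trees

/-- A relation `r` on a set `S` of natural numbers is presented computably: `S` is a computable set
and `r` is a computable relation. -/
structure IsComputablePresentation (S : Set ℕ) (r : S → S → Prop) : Prop where
  nodes : ComputablePred fun n : ℕ => n ∈ S
  rel : ComputablePred fun p : ℕ × ℕ => ∃ (h₁ : p.1 ∈ S) (h₂ : p.2 ∈ S), r ⟨p.1, h₁⟩ ⟨p.2, h₂⟩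

/-! ## Oracle programs and the Turing jump -/

/-- Programs for partial functions recursive in an oracle; the constructors are those of
`Nat.RecursiveIn`. -/
inductive OracleCode : Type
  | zero : OracleCode
  | succ : OracleCode
  | left : OracleCode
  | right : OracleCode
  | oracle : OracleCode
  | pair : OracleCode → OracleCode → OracleCode
  | comp : OracleCode → OracleCode → OracleCode
  | prec : OracleCode → OracleCode → OracleCode
  | rfind : OracleCode → OracleCode

namespace OracleCode

/-- The partial function computed by a program with oracle `g`. -/
def eval (g : ℕ →. ℕ) : OracleCode → ℕ →. ℕ
  | zero => fun _ => Part.some 0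
  | succ => fun n => Part.some (n + 1)
  | left => fun n => Part.some (Nat.unpair n).1
  | right => fun n => Part.some (Nat.unpair n).2
  | oracle => g
  | pair f h => fun n => Nat.pair <$> eval g f n <*> eval g h n
  | comp f h => fun n => eval g h n >>= eval g f
  | prec f h => fun p =>
      let (a, n) := Nat.unpair p
      n.rec (eval g f a) fun y IH => do
        let i ← IH
        eval g h (Nat.pair a (Nat.pair y i))
  | rfind f => fun a => Nat.rfind fun n => (fun m => m = 0) <$> eval g f (Nat.pair a n)

/-- The standard numbering of the programs: the numbers `0, …, 4` are the five basic programs, and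
`4 * k + i + 5` with `i < 4` applies the `i`-th constructor to the programs coded by `k` (as a pair,
except for `rfind`). -/
def ofNat : ℕ → OracleCode
  | 0 => zero
  | 1 => succ
  | 2 => left
  | 3 => right
  | 4 => oracle
  | n + 5 =>
    have h₀ : n / 4 < n + 5 := by omega
    have h₁ : (n / 4).unpair.1 < n + 5 := lt_of_le_of_lt (Nat.unpair_left_le _) h₀
    have h₂ : (n / 4).unpair.2 < n + 5 := lt_of_le_of_lt (Nat.unpair_right_le _) h₀
    match n % 4 with
    | 0 => pair (ofNat (n / 4).unpair.1) (ofNat (n / 4).unpair.2)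
    | 1 => comp (ofNat (n / 4).unpair.1) (ofNat (n / 4).unpair.2)
    | 2 => prec (ofNat (n / 4).unpair.1) (ofNat (n / 4).unpair.2)
    | _ => rfind (ofNat (n / 4))

end OracleCode

open Classical in
/-- The characteristic function of a set of natural numbers. -/
noncomputable def charFn (A : Set ℕ) : ℕ →. ℕ :=
  fun n => Part.some (if n ∈ A then 1 else 0)

/-- The Turing jump `A' = {e | Φ_e^A(e)↓}`. -/
def jump (A : Set ℕ) : Set ℕ :=
  {e | ((OracleCode.ofNat e).eval (charFn A) e).Dom}

/-- The double jump `0''` of the empty set. -/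
def zeroDoubleJump : Set ℕ := jump (jump ∅)

/-- A function from a set `S` of natural numbers to itself, as a partial function on the natural
numbers with domain `S`. -/
def toPFun {S : Set ℕ} (f : S → S) : ℕ →. ℕ :=
  fun n => ⟨n ∈ S, fun h => (f ⟨n, h⟩ : ℕ)⟩

end SelfEmb

/-! A self-embedding that is not onto must push some node upwards forever, and the tree is built so
that such a climb grows fast enough to decide `0''`.

Embeddings. Let `δ` be a self-embedding of an infinite binary branching tree in which every
extendible node has two incomparable extendible nodes above it. If no iterate moved an extendible
node strictly up, then for each height some iterate would fix all extendible nodes up to that height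
and permute the finite pieces hanging off them, so `δ` would be onto (`surjective_of_no_increase`).
Hence a nontrivial `δ` has `L` and `x` such that the orbit of `x` under `δ^[L]` increases strictly.
By splitting, `x` can be chosen so that an extendible node branches off between `x` and its image,
and applying `δ^[L]` repeats this at every step (`exists_increasing_sequence`). Since `L` and `x`
are finite information, `δ` computes this chain.

The tree. The sequence `m` codes least witnesses of a list of Σ₂ statements; stages `s` propose
sequences `Y s` with limit inferior `m` (`isApproximation_guess`). A node is a stage with a string
of bits. A stage is below a later one if its proposal is not lexicographically undercut in between;
strings must be compatible as far as the proposals agree. The infinite part consists of the true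
stages, those never undercut, with strings no longer than their agreement with `m`. Each gain in
agreement frees a bit, which gives splitting (`IsApproximation.isCore`). Conversely, core nodes
agreeing with `m` on at most `k` places have at most `2 ^ k` strings, and core nodes with equal
strings are comparable. The branchings off the chain yield pairwise incomparable core nodes whose
stages are bounded by the numbers on the chain, so after `2 ^ k + 1` of them the pigeonhole
principle gives a bounded stage agreeing with `m` on `0, …, k` (`exists_agreeing_stage`). Core nodes
have finitely many children rather than two; `binParent` makes the tree binary by stringing siblings
into a chain.

Decision. Agreement with `m` at `i` bounds a witness of the `i`-th statement if that statement is
true. For a list containing both the Σ₂ form of `e ∈ 0''` and the statements that all candidates up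
to a bound get refuted, such bounds decide `0''` (`mem_zeroDoubleJump_iff_of_bound`). -/

namespace SelfEmb

/-! ### Self-embeddings of binary branching trees -/

section EmbeddingTheory

variable {T : Type*} [PartialOrder T]

/-- A node is extendible if there are infinitely many nodes above it. -/
def Extendible (x : T) : Prop := (Set.Ici x).Infinite

/-- The number of nodes weakly below a node. -/
noncomputable def height (x : T) : ℕ := (Set.Iic x).ncard

theorem Extendible.mono {x y : T} (hy : Extendible y) (h : x ≤ y) : Extendible x :=
  Set.Infinite.mono (Set.Ici_subset_Ici.2 h) hy

theorem iterate_le_iff {f : T → T} (hf : ∀ a b, f a ≤ f b ↔ a ≤ b) (L : ℕ) (a b : T) :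
    f^[L] a ≤ f^[L] b ↔ a ≤ b := by
  induction L generalizing a b with
  | zero => rfl
  | succ n ih => rw [Function.iterate_succ_apply, Function.iterate_succ_apply, ih, hf]

theorem injective_of_le_iff {f : T → T} (hf : ∀ a b, f a ≤ f b ↔ a ≤ b) : f.Injective :=
  fun a b h => le_antisymm ((hf a b).1 h.le) ((hf b a).1 h.ge)

theorem lt_iff_of_le_iff {f : T → T} (hf : ∀ a b, f a ≤ f b ↔ a ≤ b) (a b : T) :
    f a < f b ↔ a < b := by
  rw [lt_iff_le_not_ge, lt_iff_le_not_ge, hf, hf]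

theorem Extendible.map {f : T → T} (hf : ∀ a b, f a ≤ f b ↔ a ≤ b) {x : T} (hx : Extendible x) :
    Extendible (f x) := by
  refine Set.Infinite.mono ?_ (Set.Infinite.image (injective_of_le_iff hf).injOn hx)
  rintro _ ⟨y, hy, rfl⟩
  exact (hf _ _).2 hy

theorem exists_covBy_le (hfin : ∀ n : T, (Set.Iic n).Finite) {a b : T} (h : a < b) :
    ∃ c, a ⋖ c ∧ c ≤ b := by
  have hs : {z | a < z ∧ z ≤ b}.Finite := (hfin b).subset fun z hz => hz.2
  obtain ⟨c, hc⟩ := hs.exists_minimal ⟨b, h, le_rfl⟩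
  refine ⟨c, ⟨hc.prop.1, fun d had hdc => ?_⟩, hc.prop.2⟩
  exact hdc.not_ge (hc.le_of_le ⟨had, hdc.le.trans hc.prop.2⟩ hdc.le)

theorem height_pos (hfin : ∀ n : T, (Set.Iic n).Finite) (a : T) : 0 < height a :=
  (Set.ncard_pos (hfin a)).2 ⟨a, le_rfl⟩

theorem height_covBy (hfin : ∀ n : T, (Set.Iic n).Finite)
    (hch : ∀ a b c : T, a ≤ c → b ≤ c → a ≤ b ∨ b ≤ a) {b c : T} (h : b ⋖ c) :
    height c = height b + 1 := by
  have : Set.Iic c = insert c (Set.Iic b) := by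
    ext z
    simp only [Set.mem_Iic, Set.mem_insert_iff]
    refine ⟨fun hz => ?_, ?_⟩
    · rcases eq_or_lt_of_le hz with h1 | h1
      · exact Or.inl h1
      · rcases hch z b c hz h.le with h2 | h2
        · exact Or.inr h2
        · rcases eq_or_lt_of_le h2 with h3 | h3
          · exact Or.inr h3.ge
          · exact absurd h1 (h.2 h3)
    · rintro (rfl | hz)
      · exact le_rfl
      · exact hz.trans h.le
  have hc : c ∉ Set.Iic b := fun hc => h.1.not_ge hc
  rw [height, this, Set.ncard_insert_of_notMem hc (hfin b), height]

theorem eq_or_eq_of_encard_le_two {α : Type*} {s : Set α} (hs : s.encard ≤ 2) {x y z : α}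
    (hx : x ∈ s) (hy : y ∈ s) (hz : z ∈ s) (hxy : x ≠ y) : z = x ∨ z = y := by
  by_contra! h
  have h3 : ({z, x, y} : Set α).encard = 3 := by
    rw [Set.encard_insert_of_notMem (by simp [h.1, h.2]), Set.encard_pair hxy]; rfl
  have : ({z, x, y} : Set α).encard ≤ 2 :=
    (Set.encard_le_encard (by rintro w (rfl | rfl | rfl) <;> assumption)).trans hs
  rw [h3] at this
  exact absurd this (by decide)

theorem exists_pred_covBy (hfin : ∀ n : T, (Set.Iic n).Finite) {a c : T} (h : a < c) :
    ∃ b, b ⋖ c := by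
  have hs : {z | z < c}.Finite := (hfin c).subset fun z hz => le_of_lt hz
  obtain ⟨b, hb⟩ := hs.exists_maximal ⟨a, h⟩
  refine ⟨b, hb.prop, fun d hbd hdc => ?_⟩
  exact hbd.not_ge (hb.le_of_ge hdc hbd.le)

/-- If no extendible node is moved strictly up by an iterate of an embedding, then the extendible
nodes of bounded height are all fixed by some iterate. -/
theorem exists_iterate_fixing (hfin : ∀ n : T, (Set.Iic n).Finite)
    (hch : ∀ a b c : T, a ≤ c → b ≤ c → a ≤ b ∨ b ≤ a) (hroot : ∃ r : T, ∀ n, r ≤ n)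
    (hbin : ∀ n : T, {m | n ⋖ m}.encard ≤ 2) {f : T → T} (hf : ∀ a b, f a ≤ f b ↔ a ≤ b)
    (hno : ∀ L, 1 ≤ L → ∀ x, Extendible x → ¬ x < f^[L] x) (h : ℕ) :
    ∃ L, 1 ≤ L ∧ ∀ x, Extendible x → height x ≤ h → f^[L] x = x := by
  induction h with
  | zero =>
    exact ⟨1, le_rfl, fun x _ h => absurd (height_pos hfin x) (by omega)⟩
  | succ h ih =>
    obtain ⟨L, hL, hfix⟩ := ih
    -- The iterate is doubled because `f^[L]` may still interchange the two successors of a fixed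
    -- node.
    refine ⟨L + L, by omega, fun x hx hxh => ?_⟩
    rw [Function.iterate_add_apply]
    by_cases hxh' : height x ≤ h
    · rw [hfix x hx hxh', hfix x hx hxh']
    set D := f^[L] with hD
    have hDle : ∀ a b, D a ≤ D b ↔ a ≤ b := iterate_le_iff hf L
    have hup : ∀ y, Extendible y → y ≤ D y → D y = y := fun y hy hle =>
      (hle.eq_or_lt.resolve_right (hno L hL y hy)).symm
    have hDlt := lt_iff_of_le_iff hDle
    obtain ⟨r, hr⟩ := hroot
    rcases (hr x).eq_or_lt with rfl | hrx
    · rw [hup _ hx (hr _), hup _ hx (hr _)]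
    obtain ⟨b, hb⟩ := exists_pred_covBy hfin hrx
    have hbx := height_covBy hfin hch hb
    have hDb : D b = b := hfix b (hx.mono hb.le) (by omega)
    have hbDx : b < D x := by rw [← hDb, hDlt]; exact hb.lt
    obtain ⟨x', hx', hx'D⟩ := exists_covBy_le hfin hbDx
    by_cases hxx : x = x'
    · subst hxx
      rw [hup x hx hx'D, hup x hx hx'D]
    have hx'E : Extendible x' := (hx.map hDle).mono hx'D
    have hbDx' : b < D x' := by rw [← hDb, hDlt]; exact hx'.lt
    obtain ⟨y, hy, hyD⟩ := exists_covBy_le hfin hbDx'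
    rcases eq_or_eq_of_encard_le_two (hbin b) hb hx' hy hxx with rfl | rfl
    · have h1 : y ≤ f^[L + L] y := by
        rw [Function.iterate_add_apply]
        exact hyD.trans ((hDle _ _).2 hx'D)
      have h2 := (h1.eq_or_lt.resolve_right (hno (L + L) (by omega) y hx)).symm
      rwa [Function.iterate_add_apply] at h2
    -- Here the other successor of `b` is fixed and lies below the image of `x`, hence below `x`
    -- itself, which is impossible for two distinct successors.
    · have h1 := hup y hx'E hyD
      rw [← h1, hDle] at hx'D
      rcases hx'D.eq_or_lt with h2 | h2
      · exact absurd h2.symm hxx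
      · exact absurd h2 (hb.2 hy.lt)

/-- A node `n` that is not extendible hangs off a last extendible node `x`. An iterate fixing `x`
and its extendible successors maps the part hanging off at `x` into itself; this part is finite by
binary branching, so injectivity makes the iterate onto there. -/
theorem surjective_of_no_increase (hfin : ∀ n : T, (Set.Iic n).Finite)
    (hch : ∀ a b c : T, a ≤ c → b ≤ c → a ≤ b ∨ b ≤ a) (hroot : ∃ r : T, ∀ n, r ≤ n)
    (hbin : ∀ n : T, {m | n ⋖ m}.encard ≤ 2) [Infinite T]
    {f : T → T} (hf : ∀ a b, f a ≤ f b ↔ a ≤ b)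
    (hno : ∀ L, 1 ≤ L → ∀ x, Extendible x → ¬ x < f^[L] x) : f.Surjective := by
  intro n
  -- The `+ 1` is for the extendible successors of the last extendible node below `n`.
  obtain ⟨L, hL, hfix⟩ := exists_iterate_fixing hfin hch hroot hbin hf hno (height n + 1)
  suffices h : ∃ a, f^[L] a = n by
    obtain ⟨a, ha⟩ := h
    obtain ⟨l, rfl⟩ : ∃ l, L = l + 1 := ⟨L - 1, by omega⟩
    exact ⟨f^[l] a, by rw [← ha, Function.iterate_succ_apply']⟩
  by_cases hn : Extendible n
  · exact ⟨n, hfix n hn (by omega)⟩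
  have hDle : ∀ a b, f^[L] a ≤ f^[L] b ↔ a ≤ b := iterate_le_iff hf L
  obtain ⟨r, hr⟩ := hroot
  have hrE : Extendible r := by
    have : Set.Ici r = Set.univ := Set.eq_univ_of_forall hr
    rw [Extendible, this]
    exact Set.infinite_univ
  have hs : {z : T | Extendible z ∧ z ≤ n}.Finite := (hfin n).subset fun z hz => hz.2
  obtain ⟨x, hx⟩ := hs.exists_maximal ⟨r, hrE, hr n⟩
  obtain ⟨hxE, hxn⟩ := hx.prop
  have hxh : height x ≤ height n := Set.ncard_le_ncard (Set.Iic_subset_Iic.2 hxn) (hfin n)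
  have hDx : f^[L] x = x := hfix x hxE (by omega)
  set W : Set T := {m | x ≤ m ∧ ∀ y, Extendible y → x < y → ¬ y ≤ m} with hW
  have hWfin : W.Finite := by
    have hcov : {m | x ⋖ m}.Finite := Set.finite_of_encard_le_coe (hbin x)
    have h1 : (⋃ c ∈ {m | x ⋖ m ∧ ¬ Extendible m}, Set.Ici c).Finite :=
      Set.Finite.biUnion (hcov.subset fun c hc => hc.1) fun c hc => Set.not_infinite.1 hc.2
    refine ((Set.finite_singleton x).union h1).subset fun m hm => ?_
    rcases hm.1.eq_or_lt with h | h
    · exact Or.inl h.symm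
    · obtain ⟨c, hc, hcm⟩ := exists_covBy_le hfin h
      refine Or.inr (Set.mem_biUnion (show c ∈ _ from ⟨hc, fun hcE => ?_⟩) hcm)
      exact hm.2 c hcE hc.lt hcm
  have hmaps : Set.MapsTo (f^[L]) W W := by
    refine fun m hm => ⟨?_, fun y hy hxy hym => ?_⟩
    · rw [← hDx, hDle]; exact hm.1
    · obtain ⟨c, hc, hcy⟩ := exists_covBy_le hfin hxy
      have hcE := hy.mono hcy
      have hch' := height_covBy hfin hch hc
      have hcm : f^[L] c ≤ f^[L] m := by
        rw [hfix c hcE (by omega)]; exact hcy.trans hym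
      exact hm.2 c hcE hc.lt ((hDle _ _).1 hcm)
  have hsurj := (Set.Finite.injOn_iff_bijOn_of_mapsTo hWfin hmaps).1
    (injective_of_le_iff hDle).injOn
  obtain ⟨a, -, ha⟩ := hsurj.surjOn (show n ∈ W from ⟨hxn, fun y hy hxy hyn =>
    hxy.not_ge (hx.le_of_ge ⟨hy, hyn⟩ hxy.le)⟩)
  exact ⟨a, ha⟩

/-- A self-embedding that is not onto has an iterate moving some extendible node strictly up, past
an extendible node that branches off. -/
theorem exists_increasing_node (hfin : ∀ n : T, (Set.Iic n).Finite)
    (hch : ∀ a b c : T, a ≤ c → b ≤ c → a ≤ b ∨ b ≤ a) (hroot : ∃ r : T, ∀ n, r ≤ n)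
    (hbin : ∀ n : T, {m | n ⋖ m}.encard ≤ 2) [Infinite T]
    (hsplit : ∀ x : T, Extendible x → ∃ y z, Extendible y ∧ Extendible z ∧ x ≤ y ∧ x ≤ z ∧
      ¬ y ≤ z ∧ ¬ z ≤ y)
    {f : T → T} (hf : ∀ a b, f a ≤ f b ↔ a ≤ b) (hns : ¬ f.Surjective) :
    ∃ L x z, Extendible z ∧ x ≤ z ∧ x < f^[L] x ∧ ¬ z ≤ f^[L] x ∧ ¬ f^[L] x ≤ z := by
  have : ∃ L x, Extendible x ∧ x < f^[L] x := by
    by_contra! h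
    exact hns (surjective_of_no_increase hfin hch hroot hbin hf fun L _ x hx => h L x hx)
  obtain ⟨L, x₀, hx₀, hlt₀⟩ := this
  by_contra! hcon
  set D := f^[L] with hD
  have hDle : ∀ a b, D a ≤ D b ↔ a ≤ b := iterate_le_iff hf L
  -- If nothing ever branches off, both of two incomparable extendible nodes above `x` are forced
  -- above `D x`. Iterating puts an infinite chain below a single node.
  have hstep : ∀ x, x < D x → ∀ y z, Extendible y → Extendible z → x ≤ y → x ≤ z →
      ¬ y ≤ z → ¬ z ≤ y → D x ≤ y := by
    intro x hlt y z hy hz hxy hxz hyz hzy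
    by_contra hn
    have h1 : y ≤ D x := by
      by_contra h
      exact hn (hcon L x y hy hxy hlt h)
    by_cases h2 : z ≤ D x
    · rcases hch y z _ h1 h2 with h | h
      · exact hyz h
      · exact hzy h
    · exact hyz (h1.trans (hcon L x z hz hxz hlt h2))
  obtain ⟨y, z, hy, hz, hxy, hxz, hyz, hzy⟩ := hsplit x₀ hx₀
  have hlt : ∀ n, D^[n] x₀ < D^[n + 1] x₀ := by
    intro n
    rw [Function.iterate_succ_apply]
    exact (lt_iff_of_le_iff (iterate_le_iff hDle n) _ _).2 hlt₀
  have hall : ∀ n, D^[n] x₀ ≤ y ∧ D^[n] x₀ ≤ z := by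
    intro n
    induction n with
    | zero => exact ⟨hxy, hxz⟩
    | succ n ih =>
      have h := hlt n
      rw [Function.iterate_succ_apply'] at h ⊢
      exact ⟨hstep _ h y z hy hz ih.1 ih.2 hyz hzy, hstep _ h z y hz hy ih.2 ih.1 hzy hyz⟩
  have hmono : StrictMono fun n => D^[n] x₀ := strictMono_nat_of_lt_succ hlt
  exact Set.infinite_of_injective_forall_mem hmono.injective (fun n => (hall n).1) (hfin y)

/-- The orbits of the nodes provided by `exists_increasing_node`. -/
theorem exists_increasing_sequence (hfin : ∀ n : T, (Set.Iic n).Finite)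
    (hch : ∀ a b c : T, a ≤ c → b ≤ c → a ≤ b ∨ b ≤ a) (hroot : ∃ r : T, ∀ n, r ≤ n)
    (hbin : ∀ n : T, {m | n ⋖ m}.encard ≤ 2) [Infinite T]
    (hsplit : ∀ x : T, Extendible x → ∃ y z, Extendible y ∧ Extendible z ∧ x ≤ y ∧ x ≤ z ∧
      ¬ y ≤ z ∧ ¬ z ≤ y)
    {f : T → T} (hf : ∀ a b, f a ≤ f b ↔ a ≤ b) (hns : ¬ f.Surjective) :
    ∃ (L : ℕ) (x : T) (z : ℕ → T), ∀ n, Extendible (z n) ∧ (f^[L])^[n] x ≤ z n ∧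
      (f^[L])^[n] x < (f^[L])^[n + 1] x ∧ ¬ z n ≤ (f^[L])^[n + 1] x ∧
      ¬ (f^[L])^[n + 1] x ≤ z n := by
  obtain ⟨L, x, z, hz, hxz, hlt, h1, h2⟩ :=
    exists_increasing_node hfin hch hroot hbin hsplit hf hns
  refine ⟨L, x, fun n => (f^[L])^[n] z, fun n => ?_⟩
  have hle := iterate_le_iff (iterate_le_iff hf L) n
  refine ⟨?_, (hle _ _).2 hxz, ?_, ?_, ?_⟩
  · exact hz.map hle
  all_goals rw [Function.iterate_succ_apply]
  · exact (lt_iff_of_le_iff hle _ _).2 hlt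
  · rwa [hle]
  · rwa [hle]

end EmbeddingTheory
-- Trees given by a parent function
section Ancestor

/-- A parent function on the natural numbers with root `0`. -/
structure IsParentFun (q : ℕ → ℕ) : Prop where
  zero : q 0 = 0
  lt : ∀ n, 0 < n → q n < n

/-- The ancestor relation of a parent function. -/
def Anc (q : ℕ → ℕ) (x y : ℕ) : Prop := ∃ j, q^[j] y = x

variable {q : ℕ → ℕ}

theorem Anc.refl (x : ℕ) : Anc q x x := ⟨0, rfl⟩

theorem Anc.trans {x y z : ℕ} (h : Anc q x y) (h' : Anc q y z) : Anc q x z := by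
  obtain ⟨i, rfl⟩ := h
  obtain ⟨j, rfl⟩ := h'
  exact ⟨i + j, Function.iterate_add_apply _ _ _ _⟩

theorem anc_self (y : ℕ) : Anc q (q y) y := ⟨1, rfl⟩

theorem Anc.eq_or {x y : ℕ} (h : Anc q x y) : x = y ∨ Anc q x (q y) := by
  obtain ⟨j, rfl⟩ := h
  cases j with
  | zero => exact Or.inl rfl
  | succ j => exact Or.inr ⟨j, rfl⟩

theorem Anc.linear {x y z : ℕ} (h : Anc q x z) (h' : Anc q y z) : Anc q x y ∨ Anc q y x := by
  obtain ⟨i, rfl⟩ := h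
  obtain ⟨j, rfl⟩ := h'
  rcases le_total i j with h | h
  · obtain ⟨k, rfl⟩ := Nat.exists_eq_add_of_le' h
    exact Or.inr ⟨k, (Function.iterate_add_apply _ _ _ _).symm⟩
  · obtain ⟨k, rfl⟩ := Nat.exists_eq_add_of_le' h
    exact Or.inl ⟨k, (Function.iterate_add_apply _ _ _ _).symm⟩

theorem IsParentFun.le (hq : IsParentFun q) (n : ℕ) : q n ≤ n := by
  rcases Nat.eq_zero_or_pos n with rfl | h
  · exact hq.zero.le
  · exact (hq.lt n h).le

theorem IsParentFun.le_of_anc (hq : IsParentFun q) {x y : ℕ} (h : Anc q x y) : x ≤ y := by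
  obtain ⟨j, rfl⟩ := h
  induction j with
  | zero => exact le_rfl
  | succ j ih => rw [Function.iterate_succ_apply']; exact (hq.le _).trans ih

theorem IsParentFun.anc_antisymm (hq : IsParentFun q) {x y : ℕ} (h : Anc q x y)
    (h' : Anc q y x) : x = y :=
  le_antisymm (hq.le_of_anc h) (hq.le_of_anc h')

theorem IsParentFun.zero_anc (hq : IsParentFun q) (y : ℕ) : Anc q 0 y := by
  induction y using Nat.strong_induction_on with
  | _ y ih =>
    rcases Nat.eq_zero_or_pos y with rfl | h
    · exact Anc.refl _
    · exact (ih _ (hq.lt y h)).trans (anc_self y)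

theorem IsParentFun.not_anc_of_children (hq : IsParentFun q) {c c' : ℕ} (hc : 0 < c)
    (hne : c ≠ c') (h : q c = q c') : ¬ Anc q c c' := by
  intro hcc
  rcases hcc.eq_or with h1 | h1
  · exact hne h1
  · rw [← h] at h1
    exact (hq.lt c hc).not_ge (hq.le_of_anc h1)

/-- Two incomparable nodes branch at a common ancestor. -/
theorem IsParentFun.exists_branching (hq : IsParentFun q) {x y z : ℕ} (hxz : Anc q x z)
    (hxy : Anc q x y) (hzy : ¬ Anc q z y) (hyz : ¬ Anc q y z) :
    ∃ c c', 0 < c ∧ 0 < c' ∧ c ≠ c' ∧ q c = q c' ∧ Anc q x (q c) ∧ Anc q c z ∧ Anc q c' y := by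
  classical
  -- The meet of `y` and `z` is the first node on the way down from `z` that lies below `y`.
  have h1 : ∃ j, Anc q (q^[j] z) y := by
    obtain ⟨j, rfl⟩ := hxz
    exact ⟨j, hxy⟩
  obtain ⟨j, hj⟩ : ∃ j, Nat.find h1 = j + 1 :=
    Nat.exists_eq_succ_of_ne_zero fun h0 => hzy (by simpa [h0] using Nat.find_spec h1)
  have hby := Nat.find_spec h1
  have hcy : ¬ Anc q (q^[j] z) y := Nat.find_min h1 (by omega)
  rw [hj, Function.iterate_succ_apply'] at hby
  obtain ⟨i, hi, hb⟩ : ∃ i, ¬ Anc q (q^[i] y) (q (q^[j] z)) ∧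
      q (q^[i] y) = q (q^[j] z) := by
    obtain ⟨i, hi⟩ := hby
    induction i with
    | zero =>
      refine absurd ⟨j + 1, ?_⟩ hyz
      rw [Function.iterate_succ_apply']
      exact hi.symm
    | succ i ih =>
      by_cases h : q^[i] y = q (q^[j] z)
      · exact ih h
      · rw [Function.iterate_succ_apply'] at hi
        refine ⟨i, fun ha => h ?_, hi⟩
        exact hq.anc_antisymm ha (hi ▸ anc_self _)
  have hpos : ∀ c, ¬ Anc q c (q (q^[j] z)) → 0 < c := by
    intro c hc
    rcases Nat.eq_zero_or_pos c with rfl | h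
    · exact absurd (hq.zero_anc _) hc
    · exact h
  refine ⟨q^[j] z, q^[i] y, ?_, hpos _ hi, ?_, hb.symm, ?_, ⟨j, rfl⟩, ⟨i, rfl⟩⟩
  · rcases Nat.eq_zero_or_pos (q^[j] z) with h | h
    · exact absurd (h ▸ hq.zero_anc _) hcy
    · exact h
  · intro h
    exact hcy ⟨i, h.symm⟩
  · obtain ⟨k, rfl⟩ := hxz
    have hk : j + 1 ≤ k := hj ▸ Nat.find_min' h1 hxy
    obtain ⟨l, rfl⟩ := Nat.exists_eq_add_of_le' hk
    exact ⟨l, by rw [Function.iterate_add_apply, Function.iterate_succ_apply' q j]⟩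

end Ancestor

/-! ### Making a tree on numbers binary by chaining siblings -/

section NumTree

/-- A tree order on a set of natural numbers that contains `0` as its root and is contained in the
usual order. -/
structure IsNumTree (N : ℕ → Prop) (R : ℕ → ℕ → Prop) : Prop where
  zero_mem : N 0
  zero_rel : ∀ m, N m → R 0 m
  refl : ∀ m, N m → R m m
  trans : ∀ k m n, N k → N m → N n → R k m → R m n → R k n
  le_of_rel : ∀ m n, R m n → m ≤ n
  linear : ∀ k m n, N k → N m → N n → R k n → R m n → k ≤ m → R k m

variable (N : ℕ → Prop) (R : ℕ → ℕ → Prop)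

open Classical in
/-- The immediate predecessor of a node. -/
noncomputable def parent (m : ℕ) : ℕ := Nat.findGreatest (fun k => N k ∧ R k m) (m - 1)

open Classical in
/-- The previous sibling of a node, or `0` if there is none. -/
noncomputable def prevSibling (m : ℕ) : ℕ :=
  Nat.findGreatest (fun k => N k ∧ 0 < k ∧ parent N R k = parent N R m) (m - 1)

/-- The parent function of the binary tree that represents the children of each node as a chain:
the node `n` is split into `2 * n` and `2 * n + 1`. -/
noncomputable def binParent (x : ℕ) : ℕ :=
  if x % 2 = 1 then x - 1 else
  if x = 0 then 0 else
  if prevSibling N R (x / 2) = 0 then 2 * parent N R (x / 2) + 1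
  else 2 * prevSibling N R (x / 2)

variable {N R}

theorem binParent_odd (n : ℕ) : binParent N R (2 * n + 1) = 2 * n := by
  simp [binParent, Nat.add_mod]

theorem binParent_zero : binParent N R 0 = 0 := by simp [binParent]

theorem binParent_even_of_eq_zero {n : ℕ} (hn : 0 < n) (h : prevSibling N R n = 0) :
    binParent N R (2 * n) = 2 * parent N R n + 1 := by
  simp [binParent, h, hn.ne']

theorem binParent_even_of_ne_zero {n : ℕ} (hn : 0 < n) (h : prevSibling N R n ≠ 0) :
    binParent N R (2 * n) = 2 * prevSibling N R n := by
  simp [binParent, h, hn.ne']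

namespace IsNumTree

variable (H : IsNumTree N R)
include H

theorem parent_spec {m : ℕ} (hm : N m) : N (parent N R m) ∧ R (parent N R m) m := by
  classical
  exact Nat.findGreatest_spec (P := fun k => N k ∧ R k m) (Nat.zero_le (m - 1))
    ⟨H.zero_mem, H.zero_rel m hm⟩

omit H in
theorem parent_lt {m : ℕ} (hm : 0 < m) : parent N R m < m := by
  classical
  have := Nat.findGreatest_le (P := fun k => N k ∧ R k m) (m - 1)
  simp only [parent]
  omega

theorem rel_parent {k m : ℕ} (hk : N k) (hm : N m) (hkm : R k m) (hne : k ≠ m) :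
    R k (parent N R m) := by
  classical
  have hlt := lt_of_le_of_ne (H.le_of_rel _ _ hkm) hne
  obtain ⟨h1, h2⟩ := H.parent_spec hm
  refine H.linear _ _ _ hk h1 hm hkm h2 ?_
  exact Nat.le_findGreatest (by omega) ⟨hk, hkm⟩

omit H in
theorem prevSibling_spec {m : ℕ} (h : prevSibling N R m ≠ 0) :
    N (prevSibling N R m) ∧ parent N R (prevSibling N R m) = parent N R m ∧
      prevSibling N R m < m := by
  classical
  have h1 := Nat.findGreatest_of_ne_zero (P := fun k => N k ∧ 0 < k ∧ parent N R k = parent N R m)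
    (n := m - 1) (m := prevSibling N R m) rfl h
  have h2 := Nat.findGreatest_le (P := fun k => N k ∧ 0 < k ∧ parent N R k = parent N R m) (m - 1)
  refine ⟨h1.1, h1.2.2, ?_⟩
  have : prevSibling N R m ≤ m - 1 := h2
  omega

omit H in
theorem le_prevSibling {k m : ℕ} (hk : N k) (hk0 : 0 < k) (h : parent N R k = parent N R m)
    (hkm : k < m) : k ≤ prevSibling N R m := by
  classical
  exact Nat.le_findGreatest (by omega) ⟨hk, hk0, h⟩

omit H in
theorem isParentFun : IsParentFun (binParent N R) := by
  refine ⟨binParent_zero, fun x hx => ?_⟩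
  obtain ⟨n, rfl | rfl⟩ := Nat.even_or_odd' x
  · have hn : 0 < n := by omega
    by_cases h : prevSibling N R n = 0
    · rw [binParent_even_of_eq_zero hn h]
      have := parent_lt (N := N) (R := R) hn
      omega
    · rw [binParent_even_of_ne_zero hn h]
      have := (prevSibling_spec h).2.2
      omega
  · rw [binParent_odd]; omega

theorem binParent_mem {x : ℕ} (hx : N (x / 2)) : N (binParent N R x / 2) := by
  obtain ⟨n, rfl | rfl⟩ := Nat.even_or_odd' x
  · rcases Nat.eq_zero_or_pos n with rfl | hn
    · simpa [binParent_zero] using H.zero_mem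
    have hn' : N n := by simpa using hx
    by_cases h : prevSibling N R n = 0
    · rw [binParent_even_of_eq_zero hn h]
      have := (H.parent_spec hn').1
      rwa [show (2 * parent N R n + 1) / 2 = parent N R n by omega]
    · rw [binParent_even_of_ne_zero hn h]
      simpa using (prevSibling_spec h).1
  · rw [binParent_odd]
    have : (2 * n + 1) / 2 = n := by omega
    rw [this] at hx
    simpa using hx

theorem mem_of_anc {x y : ℕ} (h : Anc (binParent N R) x y) (hy : N (y / 2)) : N (x / 2) := by
  obtain ⟨j, rfl⟩ := h
  induction j with
  | zero => exact hy
  | succ j ih => rw [Function.iterate_succ_apply']; exact H.binParent_mem ih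

omit H in
/-- Distinct children have distinct parity. -/
theorem eq_of_binParent_eq {c c' : ℕ} (hc : N (c / 2)) (hc' : N (c' / 2)) (h0 : 0 < c)
    (h0' : 0 < c') (h : binParent N R c = binParent N R c') (hmod : c % 2 = c' % 2) : c = c' := by
  obtain ⟨n, rfl | rfl⟩ := Nat.even_or_odd' c
  · obtain ⟨n', rfl | rfl⟩ := Nat.even_or_odd' c'
    · have hn : N n := by simpa using hc
      have hn' : N n' := by simpa using hc'
      -- Two even nodes with one parent would be two first children of a node, or two immediate
      -- followers of one sibling; the later of them would have the earlier one, or something beyond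
      -- it, as previous sibling.
      have key : ∀ a b, N a → N b → 0 < a → 0 < b →
          binParent N R (2 * a) = binParent N R (2 * b) → ¬ a < b := by
        intro a b ha hb ha0 hb0 hab hlt
        by_cases h1 : prevSibling N R a = 0
        · by_cases h2 : prevSibling N R b = 0
          · rw [binParent_even_of_eq_zero ha0 h1, binParent_even_of_eq_zero hb0 h2] at hab
            have := le_prevSibling ha ha0 (by omega : parent N R a = parent N R b) hlt
            omega
          · rw [binParent_even_of_eq_zero ha0 h1, binParent_even_of_ne_zero hb0 h2] at hab
            omega
        · by_cases h2 : prevSibling N R b = 0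
          · rw [binParent_even_of_ne_zero ha0 h1, binParent_even_of_eq_zero hb0 h2] at hab
            omega
          · rw [binParent_even_of_ne_zero ha0 h1, binParent_even_of_ne_zero hb0 h2] at hab
            have h3 := prevSibling_spec h1
            have h4 := prevSibling_spec h2
            have h5 : prevSibling N R a = prevSibling N R b := by omega
            have := le_prevSibling ha ha0 (by rw [← h3.2.1, h5, h4.2.1]) hlt
            omega
      have h1 := key n n' hn hn' (by omega) (by omega) h
      have h2 := key n' n hn' hn (by omega) (by omega) h.symm
      omega
    · omega
  · obtain ⟨n', rfl | rfl⟩ := Nat.even_or_odd' c'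
    · omega
    · rw [binParent_odd, binParent_odd] at h
      omega

omit H in
theorem anc_even_of_sibling {n n' : ℕ} (hn : N n) (hn0 : 0 < n)
    (h : parent N R n = parent N R n') (hle : n ≤ n') :
    Anc (binParent N R) (2 * n) (2 * n') := by
  induction n' using Nat.strong_induction_on with
  | _ n' ih =>
    rcases hle.eq_or_lt with rfl | hlt
    · exact Anc.refl _
    · have h1 := le_prevSibling hn hn0 h hlt
      have h2 : prevSibling N R n' ≠ 0 := by omega
      have h3 := prevSibling_spec h2
      refine (ih _ h3.2.2 (h.trans h3.2.1.symm) h1).trans ?_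
      rw [← binParent_even_of_ne_zero (by omega) h2]
      exact anc_self _

omit H in
theorem anc_parent {m : ℕ} (hm : 0 < m) :
    Anc (binParent N R) (2 * parent N R m + 1) (2 * m) := by
  induction m using Nat.strong_induction_on with
  | _ m ih =>
    by_cases h : prevSibling N R m = 0
    · rw [← binParent_even_of_eq_zero hm h]
      exact anc_self _
    · have h3 := prevSibling_spec h
      rw [← h3.2.1]
      refine (ih _ h3.2.2 (by omega)).trans ?_
      rw [← binParent_even_of_ne_zero hm h]
      exact anc_self _

theorem anc_odd_of_rel {n m : ℕ} (hn : N n) (hm : N m) (h : R n m) :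
    Anc (binParent N R) (2 * n + 1) (2 * m + 1) := by
  induction m using Nat.strong_induction_on with
  | _ m ih =>
    by_cases hnm : n = m
    · rw [hnm]; exact Anc.refl _
    · have hm0 : 0 < m := by have := H.le_of_rel _ _ h; omega
      refine (ih _ (parent_lt hm0) (H.parent_spec hm).1 (H.rel_parent hn hm h hnm)).trans ?_
      refine (anc_parent hm0).trans ?_
      have := anc_self (q := binParent N R) (2 * m + 1)
      rwa [binParent_odd] at this

/-- Going down from `2 * m` one passes the even nodes of earlier siblings until the odd node of the
parent, so an odd node is met only from there on. The induction alternates between the two claims.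
-/
theorem rel_of_anc_odd_aux {n : ℕ} (hn : N n) (m : ℕ) (hm : N m) :
    (Anc (binParent N R) (2 * n + 1) (2 * m) → R n (parent N R m)) ∧
      (Anc (binParent N R) (2 * n + 1) (2 * m + 1) → R n m) := by
  induction m using Nat.strong_induction_on with
  | _ m ih =>
    have h1 : Anc (binParent N R) (2 * n + 1) (2 * m) → R n (parent N R m) ∧ 0 < m := by
      intro h
      rcases h.eq_or with h | h
      · omega
      rcases Nat.eq_zero_or_pos m with rfl | hm0
      · rw [Nat.mul_zero, binParent_zero] at h
        have := isParentFun.le_of_anc h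
        omega
      refine ⟨?_, hm0⟩
      by_cases hs : prevSibling N R m = 0
      · rw [binParent_even_of_eq_zero hm0 hs] at h
        exact (ih _ (parent_lt hm0) (H.parent_spec hm).1).2 h
      · rw [binParent_even_of_ne_zero hm0 hs] at h
        have h3 := prevSibling_spec hs
        rw [← h3.2.1]
        exact (ih _ h3.2.2 h3.1).1 h
    refine ⟨fun h => (h1 h).1, fun h => ?_⟩
    rcases h.eq_or with h | h
    · obtain rfl : n = m := by omega
      exact H.refl _ hn
    · rw [binParent_odd] at h
      obtain ⟨h2, h3⟩ := h1 h
      obtain ⟨h4, h5⟩ := H.parent_spec hm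
      exact H.trans _ _ _ hn h4 hm h2 h5

theorem rel_of_anc_odd {n x : ℕ} (hn : N n) (hx : N (x / 2))
    (h : Anc (binParent N R) (2 * n + 1) x) : R n (x / 2) := by
  obtain ⟨m, rfl | rfl⟩ := Nat.even_or_odd' x
  · rw [show 2 * m / 2 = m by omega] at hx ⊢
    obtain ⟨h4, h5⟩ := H.parent_spec hx
    exact H.trans _ _ _ hn h4 hx ((H.rel_of_anc_odd_aux hn m hx).1 h) h5
  · rw [show (2 * m + 1) / 2 = m by omega] at hx ⊢
    exact (H.rel_of_anc_odd_aux hn m hx).2 h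

/-- Every node above `2 * n` lies above a later sibling of `n`. -/
theorem exists_sibling_of_anc_even {n : ℕ} (hn : N n) (hn0 : 0 < n) (x : ℕ) (hx : N (x / 2))
    (h : Anc (binParent N R) (2 * n) x) :
    ∃ n', N n' ∧ n ≤ n' ∧ parent N R n' = parent N R n ∧ R n' (x / 2) := by
  induction x using Nat.strong_induction_on with
  | _ x ih =>
    rcases h.eq_or with h | h
    · subst h
      refine ⟨n, hn, le_rfl, rfl, ?_⟩
      rw [show 2 * n / 2 = n by omega]
      exact H.refl _ hn
    have hx0 : 0 < x := by
      rcases Nat.eq_zero_or_pos x with rfl | hx0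
      · rw [binParent_zero] at h
        have := isParentFun.le_of_anc h
        omega
      · exact hx0
    obtain ⟨n', h1, h2, h3, h4⟩ := ih _ (isParentFun.lt x hx0) (H.binParent_mem hx) h
    obtain ⟨m, rfl | rfl⟩ := Nat.even_or_odd' x
    · have hm0 : 0 < m := by omega
      rw [show 2 * m / 2 = m by omega] at hx ⊢
      obtain ⟨hp1, hp2⟩ := H.parent_spec hx
      by_cases hs : prevSibling N R m = 0
      · rw [binParent_even_of_eq_zero hm0 hs,
          show (2 * parent N R m + 1) / 2 = parent N R m by omega] at h4
        exact ⟨n', h1, h2, h3, H.trans _ _ _ h1 hp1 hx h4 hp2⟩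
      · rw [binParent_even_of_ne_zero hm0 hs,
          show 2 * prevSibling N R m / 2 = prevSibling N R m by omega] at h4
        have hs' := prevSibling_spec hs
        by_cases he : n' = prevSibling N R m
        · exact ⟨m, hx, by omega, by rw [← h3, he, hs'.2.1], H.refl _ hx⟩
        · have := H.rel_parent h1 hs'.1 h4 he
          rw [hs'.2.1] at this
          exact ⟨n', h1, h2, h3, H.trans _ _ _ h1 hp1 hx this hp2⟩
    · rw [binParent_odd, show 2 * m / 2 = m by omega] at h4
      rw [show (2 * m + 1) / 2 = m by omega]
      exact ⟨n', h1, h2, h3, h4⟩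

end IsNumTree

end NumTree
-- Splitting of extendible nodes implies type 3
section TypeThree

variable {T : Type*} [PartialOrder T]

theorem isSuccessor_iff_covBy {a b : T} : IsSuccessor (fun x y : T => x ≤ y) a b ↔ a ⋖ b := by
  constructor
  · rintro ⟨h1, h2, h3⟩
    refine ⟨lt_of_le_of_ne h1 h2, fun c hac hcb => ?_⟩
    rcases h3 c hac.le hcb.le with rfl | rfl
    · exact lt_irrefl _ hac
    · exact lt_irrefl _ hcb
  · intro h
    exact ⟨h.le, h.ne, fun k hk hk' => (h.eq_or_eq hk hk')⟩

/-- Splitting provides a strictly larger extendible node again and again; the resulting infinite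
chain is then enlarged to a maximal one. -/
theorem exists_path_of_extendible
    (hsplit : ∀ x : T, Extendible x → ∃ y z, Extendible y ∧ Extendible z ∧ x ≤ y ∧ x ≤ z ∧
      ¬ y ≤ z ∧ ¬ z ≤ y) {y : T} (hy : Extendible y) :
    ∃ P : Set T, IsPath (fun a b : T => a ≤ b) P ∧ y ∈ P := by
  have hstep : ∀ x : {x : T // Extendible x}, ∃ x' : {x : T // Extendible x}, x.1 < x'.1 := by
    rintro ⟨x, hx⟩
    obtain ⟨y, z, hy, hz, hxy, hxz, hyz, -⟩ := hsplit x hx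
    rcases hxy.eq_or_lt with rfl | h
    · exact absurd hxz hyz
    · exact ⟨⟨y, hy⟩, h⟩
  choose f hf using hstep
  have hmono : StrictMono fun n => (f^[n] ⟨y, hy⟩).1 := by
    refine strictMono_nat_of_lt_succ fun n => ?_
    rw [Function.iterate_succ_apply']
    exact hf _
  have hchain : IsChain (fun a b : T => a ≤ b) (Set.range fun n => (f^[n] ⟨y, hy⟩).1) :=
    hmono.monotone.isChain_range
  obtain ⟨M, hM, hsub⟩ := hchain.exists_maxChain
  exact ⟨M, ⟨(Set.infinite_range_of_injective hmono.injective).mono hsub, hM⟩, hsub ⟨0, rfl⟩⟩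

/-- A predecessor of a member is comparable with every member, because predecessors of a node form a
chain; maximality then puts it into the path. -/
theorem mem_path_of_le (hch : ∀ a b c : T, a ≤ c → b ≤ c → a ≤ b ∨ b ≤ a) {P : Set T}
    (hP : IsPath (fun a b : T => a ≤ b) P) {n y : T} (hy : y ∈ P) (hn : n ≤ y) : n ∈ P := by
  have h1 : IsChain (fun a b : T => a ≤ b) (insert n P) := by
    refine hP.2.1.insert fun c hc _ => ?_
    rcases hP.2.1.total hc hy with h | h
    · exact hch n c y hn h
    · exact Or.inl (hn.trans h)
  rw [hP.2.2 h1 (Set.subset_insert n P)]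
  exact Set.mem_insert n P

/-- Of two incomparable extendible nodes above `n`, at least one is strictly above, so `n` is not
maximal infinite. Each lies on a path through `n`, and no single path contains both. -/
theorem isType3_of_split (hfin : ∀ n : T, (Set.Iic n).Finite)
    (hch : ∀ a b c : T, a ≤ c → b ≤ c → a ≤ b ∨ b ≤ a) [Infinite T]
    (hsplit : ∀ x : T, Extendible x → ∃ y z, Extendible y ∧ Extendible z ∧ x ≤ y ∧ x ≤ z ∧
      ¬ y ≤ z ∧ ¬ z ≤ y) : IsType3 (fun a b : T => a ≤ b) := by
  refine ⟨inferInstance, ?_, ?_⟩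
  · rintro n ⟨hn, hfin'⟩
    obtain ⟨y, z, hy, hz, hxy, hxz, hyz, -⟩ := hsplit n hn
    refine hy (hfin' y hxy fun h => ?_)
    subst h
    exact hyz hxz
  · rintro P ⟨hP, n, hn, huniq⟩
    have hnE : Extendible n := by
      intro hfin'
      refine hP.1 (((hfin n).union hfin').subset fun c hc => ?_)
      exact (hP.2.1.total hc hn).imp id id
    obtain ⟨y, z, hy, hz, hny, hnz, hyz, hzy⟩ := hsplit n hnE
    obtain ⟨Py, hPy, hyP⟩ := exists_path_of_extendible hsplit hy
    obtain ⟨Pz, hPz, hzP⟩ := exists_path_of_extendible hsplit hz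
    rw [huniq Py hPy (mem_path_of_le hch hPy hyP hny)] at hyP
    rw [huniq Pz hPz (mem_path_of_le hch hPz hzP hnz)] at hzP
    rcases hP.2.1.total hyP hzP with h | h
    · exact hyz h
    · exact hzy h

end TypeThree

/-! ### The infinite part of a tree and its trace in the binary tree -/

section Core

/-- The infinite part `E` of a tree of natural numbers that is finitely branching and has no
isolated paths. -/
structure IsCore (N : ℕ → Prop) (R : ℕ → ℕ → Prop) (E : ℕ → Prop) : Prop where
  mem : ∀ n, E n → N n
  nonempty : ∃ n, E n
  finite_above : ∀ n, N n → ¬ E n → {m | N m ∧ R n m}.Finite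
  finite_children : ∀ n, E n → {m | N m ∧ parent N R m = n}.Finite
  split : ∀ n, E n → ∃ m m', E m ∧ E m' ∧ R n m ∧ R n m' ∧ ¬ R m m' ∧ ¬ R m' m

/-- The nodes of the binary tree. -/
def BinNode (N : ℕ → Prop) : Set ℕ := {x | N (x / 2)}

/-- The order of the binary tree. -/
def binLE (N : ℕ → Prop) (R : ℕ → ℕ → Prop) (x y : BinNode N) : Prop :=
  Anc (binParent N R) (x : ℕ) (y : ℕ)

/-- The binary tree as a partially ordered type. -/
def BinTree (N : ℕ → Prop) (_ : ℕ → ℕ → Prop) : Type := BinNode N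

/-- The number of a node. -/
def BinTree.code {N : ℕ → Prop} {R : ℕ → ℕ → Prop} (x : BinTree N R) : ℕ := Subtype.val x

instance (N : ℕ → Prop) (R : ℕ → ℕ → Prop) : PartialOrder (BinTree N R) where
  le x y := binLE N R x y
  le_refl _ := Anc.refl _
  le_trans _ _ _ h h' := Anc.trans h h'
  le_antisymm _ _ h h' := Subtype.ext (IsNumTree.isParentFun.anc_antisymm h h')

variable {N : ℕ → Prop} {R : ℕ → ℕ → Prop} {E : ℕ → Prop}

namespace BinTree

theorem code_injective : Function.Injective (code : BinTree N R → ℕ) := Subtype.val_injective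

theorem code_mem (x : BinTree N R) : N (x.code / 2) := x.2

theorem le_iff {x y : BinTree N R} : x ≤ y ↔ Anc (binParent N R) x.code y.code := Iff.rfl

theorem exists_code_eq {n : ℕ} (hn : N (n / 2)) : ∃ x : BinTree N R, x.code = n := ⟨⟨n, hn⟩, rfl⟩

theorem le_linear (a b c : BinTree N R) (h : a ≤ c) (h' : b ≤ c) : a ≤ b ∨ b ≤ a :=
  Anc.linear h h'

theorem exists_root (H : IsNumTree N R) : ∃ r : BinTree N R, ∀ n, r ≤ n := by
  obtain ⟨r, hr⟩ := exists_code_eq (N := N) (R := R) (n := 0) H.zero_mem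
  refine ⟨r, fun n => ?_⟩
  rw [le_iff, hr]
  exact IsNumTree.isParentFun.zero_anc _

theorem finite_Iic (n : BinTree N R) : (Set.Iic n).Finite := by
  refine Set.Finite.of_finite_image (f := code) ?_ code_injective.injOn
  refine (Set.finite_Iic n.code).subset ?_
  rintro _ ⟨m, hm, rfl⟩
  exact IsNumTree.isParentFun.le_of_anc hm

theorem binParent_eq_of_covBy (H : IsNumTree N R) {a b : BinTree N R} (h : a ⋖ b) :
    0 < b.code ∧ binParent N R b.code = a.code := by
  have hle := le_iff.1 h.le
  have hne : a.code ≠ b.code := fun he => h.ne (code_injective he)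
  have hlt := lt_of_le_of_ne (IsNumTree.isParentFun.le_of_anc hle) hne
  have hpos : 0 < b.code := by omega
  refine ⟨hpos, ?_⟩
  obtain ⟨c, hc⟩ := exists_code_eq (R := R) (H.binParent_mem b.code_mem)
  have hac : a ≤ c := by
    rw [le_iff, hc]
    exact hle.eq_or.resolve_left hne
  have hcb : c ≤ b := by
    rw [le_iff, hc]
    exact anc_self _
  rw [← hc]
  rcases h.eq_or_eq hac hcb with h2 | h2
  · rw [h2]
  · have := IsNumTree.isParentFun (N := N) (R := R) |>.lt _ hpos
    rw [← hc, h2] at this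
    exact absurd this (lt_irrefl _)

/-- The parity of its number distinguishes a child from its siblings. -/
theorem encard_covBy_le_two (H : IsNumTree N R) (a : BinTree N R) : {b | a ⋖ b}.encard ≤ 2 := by
  have hinj : Set.InjOn (fun b : BinTree N R => b.code % 2) {b | a ⋖ b} := by
    intro b hb c hc hbc
    obtain ⟨h1, h2⟩ := binParent_eq_of_covBy H hb
    obtain ⟨h3, h4⟩ := binParent_eq_of_covBy H hc
    exact code_injective
      (IsNumTree.eq_of_binParent_eq b.code_mem c.code_mem h1 h3 (h2.trans h4.symm) hbc)
  rw [← hinj.encard_image]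
  refine (Set.encard_le_encard (t := {0, 1}) ?_).trans ?_
  · rintro _ ⟨b, -, rfl⟩
    have := Nat.mod_two_eq_zero_or_one b.code
    simpa using this
  · rw [Set.encard_pair (by decide)]

theorem extendible_iff {x : BinTree N R} :
    Extendible x ↔ {y | N (y / 2) ∧ Anc (binParent N R) x.code y}.Infinite := by
  have : {y | N (y / 2) ∧ Anc (binParent N R) x.code y} = code '' (Set.Ici x) := by
    ext y
    constructor
    · rintro ⟨h1, h2⟩
      obtain ⟨y, rfl⟩ := exists_code_eq (R := R) h1
      exact ⟨y, h2, rfl⟩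
    · rintro ⟨y, hy, rfl⟩
      exact ⟨y.code_mem, hy⟩
  rw [this]
  exact (Set.infinite_image_iff code_injective.injOn).symm

end BinTree

namespace IsCore

variable (H : IsNumTree N R) (C : IsCore N R E)
include H C

theorem infinite_above {n : ℕ} (hn : E n) : {m | E m ∧ R n m}.Infinite := by
  intro hfin
  obtain ⟨m, hm⟩ := hfin.exists_maximal ⟨n, hn, H.refl _ (C.mem n hn)⟩
  obtain ⟨hmE, hnm⟩ := hm.prop
  obtain ⟨a, b, ha, hb, hma, hmb, hab, hba⟩ := C.split m hmE
  have key : ∀ c, E c → R m c → c = m := fun c hc hmc =>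
    le_antisymm (hm.le_of_ge ⟨hc, H.trans _ _ _ (C.mem _ hn) (C.mem _ hmE) (C.mem _ hc) hnm hmc⟩
      (H.le_of_rel _ _ hmc)) (H.le_of_rel _ _ hmc)
  rw [key a ha hma, key b hb hmb] at hab
  exact hab (H.refl _ (C.mem _ hmE))

theorem extendible_odd {n : ℕ} (hn : E n) :
    {x | N (x / 2) ∧ Anc (binParent N R) (2 * n + 1) x}.Infinite := by
  refine Set.Infinite.mono ?_ ((C.infinite_above H hn).image (f := fun m => 2 * m + 1)
    (fun a _ b _ h => by simpa using h))
  rintro _ ⟨m, ⟨hm, hnm⟩, rfl⟩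
  have hmN := C.mem m hm
  refine ⟨?_, H.anc_odd_of_rel (C.mem n hn) hmN hnm⟩
  rwa [show (2 * m + 1) / 2 = m by omega]

omit H C in
theorem finite_of_halves {A : Set ℕ} {B : Set ℕ} (hB : B.Finite) (h : ∀ x ∈ A, x / 2 ∈ B) :
    A.Finite := by
  refine ((hB.image fun m => 2 * m).union (hB.image fun m => 2 * m + 1)).subset fun x hx => ?_
  obtain ⟨n, hn | hn⟩ := Nat.even_or_odd' x
  · exact Or.inl ⟨x / 2, h x hx, by dsimp only; omega⟩
  · exact Or.inr ⟨x / 2, h x hx, by dsimp only; omega⟩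

theorem of_extendible_odd {n : ℕ} (hn : N n)
    (h : {x | N (x / 2) ∧ Anc (binParent N R) (2 * n + 1) x}.Infinite) : E n := by
  by_contra hE
  exact h (finite_of_halves (C.finite_above n hn hE) fun x hx =>
    ⟨hx.1, H.rel_of_anc_odd hn hx.1 hx.2⟩)

/-- Everything above `2 * n` lies over `n` or a later sibling. There are finitely many of these, or
else finitely many nodes over the parent altogether; if none were in the core, only finitely many
nodes would lie above. -/
theorem exists_sibling_of_extendible_even {n : ℕ} (hn : N n) (hn0 : 0 < n)
    (h : {x | N (x / 2) ∧ Anc (binParent N R) (2 * n) x}.Infinite) :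
    ∃ m, E m ∧ n ≤ m ∧ parent N R m = parent N R n := by
  by_contra! hE
  have hsib : {m | N m ∧ n ≤ m ∧ parent N R m = parent N R n}.Finite := by
    by_cases hp : E (parent N R n)
    · exact (C.finite_children _ hp).subset fun m hm => ⟨hm.1, hm.2.2⟩
    · refine (C.finite_above _ (H.parent_spec hn).1 hp).subset fun m hm => ⟨hm.1, ?_⟩
      rw [← hm.2.2]
      exact (H.parent_spec hm.1).2
  have hB : (⋃ m ∈ {m | N m ∧ n ≤ m ∧ parent N R m = parent N R n},
      {k | N k ∧ R m k}).Finite :=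
    hsib.biUnion fun m hm => C.finite_above m hm.1 fun hmE => hE m hmE hm.2.1 hm.2.2
  refine h (finite_of_halves hB fun x hx => ?_)
  obtain ⟨n', h1, h2, h3, h4⟩ := H.exists_sibling_of_anc_even hn hn0 x hx.1 hx.2
  exact Set.mem_biUnion (show n' ∈ _ from ⟨h1, h2, h3⟩) ⟨hx.1, h4⟩

theorem exists_core_above {x : ℕ} (hx : N (x / 2))
    (h : {y | N (y / 2) ∧ Anc (binParent N R) x y}.Infinite) :
    ∃ n, E n ∧ Anc (binParent N R) x (2 * n + 1) := by
  obtain ⟨n, rfl | rfl⟩ := Nat.even_or_odd' x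
  · rcases Nat.eq_zero_or_pos n with rfl | hn
    · obtain ⟨m, hm⟩ := C.nonempty
      exact ⟨m, hm, IsNumTree.isParentFun.zero_anc _⟩
    · rw [show 2 * n / 2 = n by omega] at hx
      obtain ⟨m, hm, hnm, hp⟩ := C.exists_sibling_of_extendible_even H hx hn h
      refine ⟨m, hm, (IsNumTree.anc_even_of_sibling hx hn hp.symm hnm).trans ?_⟩
      have := anc_self (q := binParent N R) (2 * m + 1)
      rwa [binParent_odd] at this
  · rw [show (2 * n + 1) / 2 = n by omega] at hx
    exact ⟨n, C.of_extendible_odd H hx h, Anc.refl _⟩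

theorem binTree_split (x : BinTree N R) (hx : Extendible x) :
    ∃ y z : BinTree N R, Extendible y ∧ Extendible z ∧ x ≤ y ∧ x ≤ z ∧ ¬ y ≤ z ∧ ¬ z ≤ y := by
  obtain ⟨n, hn, hxn⟩ := C.exists_core_above H x.code_mem (BinTree.extendible_iff.1 hx)
  obtain ⟨a, b, ha, hb, hna, hnb, hab, hba⟩ := C.split n hn
  have key : ∀ a, E a → R n a → ∃ y : BinTree N R, y.code = 2 * a + 1 ∧ Extendible y ∧ x ≤ y := by
    intro a ha hna
    have ha' : N ((2 * a + 1) / 2) := by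
      rw [show (2 * a + 1) / 2 = a by omega]; exact C.mem a ha
    obtain ⟨y, hy⟩ := BinTree.exists_code_eq (R := R) ha'
    refine ⟨y, hy, ?_, ?_⟩
    · rw [BinTree.extendible_iff, hy]
      exact C.extendible_odd H ha
    · rw [BinTree.le_iff, hy]
      exact hxn.trans (H.anc_odd_of_rel (C.mem n hn) (C.mem a ha) hna)
  have hnle : ∀ (a b : ℕ) (y z : BinTree N R), E a → ¬ R a b → y.code = 2 * a + 1 →
      z.code = 2 * b + 1 → ¬ y ≤ z := by
    intro a b y z ha hab hy hz h
    rw [BinTree.le_iff, hy] at h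
    have := H.rel_of_anc_odd (C.mem a ha) z.code_mem h
    rw [hz, show (2 * b + 1) / 2 = b by omega] at this
    exact hab this
  obtain ⟨y, hy, hye, hxy⟩ := key a ha hna
  obtain ⟨z, hz, hze, hxz⟩ := key b hb hnb
  exact ⟨y, z, hye, hze, hxy, hxz, hnle a b y z ha hab hy hz, hnle b a z y hb hba hz hy⟩

theorem infinite_binTree : Infinite (BinTree N R) := by
  obtain ⟨n, hn⟩ := C.nonempty
  have : {x | N (x / 2)}.Infinite := (C.extendible_odd H hn).mono fun x hx => hx.1
  exact this.to_subtype

/-- The branching node is even, say `2 * a`, with children `2 * a + 1` and the even node of the next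
sibling of `a`. The odd child is extendible, so `n = a` is in the core, and its number is bounded by
`y`. The core node `φ` on the side of `z` is `a` or a later sibling and may be arbitrarily large;
only its sibling `n` ties it to `y`. -/
theorem exists_branching_core {x y z : ℕ} (hy : N (y / 2)) (hz : N (z / 2))
    (hye : {w | N (w / 2) ∧ Anc (binParent N R) y w}.Infinite)
    (hze : {w | N (w / 2) ∧ Anc (binParent N R) z w}.Infinite)
    (hxz : Anc (binParent N R) x z)
    (hxy : Anc (binParent N R) x y) (hzy : ¬ Anc (binParent N R) z y)
    (hyz : ¬ Anc (binParent N R) y z) :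
    ∃ c c' φ n, ¬ Anc (binParent N R) c c' ∧ ¬ Anc (binParent N R) c' c ∧
      Anc (binParent N R) x c ∧ Anc (binParent N R) c' y ∧ Anc (binParent N R) c (2 * φ + 1) ∧
      E φ ∧ E n ∧ 0 < n ∧ parent N R φ = parent N R n ∧ n ≤ y := by
  obtain ⟨c, c', hc0, hc0', hne, hq, hxc, hcz, hcy⟩ :=
    IsNumTree.isParentFun.exists_branching hxz hxy hzy hyz
  have hq' := IsNumTree.isParentFun (N := N) (R := R)
  have h1 := hq'.not_anc_of_children hc0 hne hq
  have h2 := hq'.not_anc_of_children hc0' hne.symm hq.symm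
  have hcN := H.mem_of_anc hcz hz
  have hcN' := H.mem_of_anc hcy hy
  have hce : {w | N (w / 2) ∧ Anc (binParent N R) c w}.Infinite :=
    hze.mono fun w hw => ⟨hw.1, hcz.trans hw.2⟩
  have hce' : {w | N (w / 2) ∧ Anc (binParent N R) c' w}.Infinite :=
    hye.mono fun w hw => ⟨hw.1, hcy.trans hw.2⟩
  have hmod : c % 2 ≠ c' % 2 := fun h =>
    hne (IsNumTree.eq_of_binParent_eq hcN hcN' hc0 hc0' hq h)
  have key : ∀ n n', 0 < n' → binParent N R (2 * n + 1) = binParent N R (2 * n') →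
      prevSibling N R n' = n ∧ prevSibling N R n' ≠ 0 := by
    intro n n' hn' h
    rw [binParent_odd] at h
    by_cases hs : prevSibling N R n' = 0
    · rw [binParent_even_of_eq_zero hn' hs] at h
      omega
    · rw [binParent_even_of_ne_zero hn' hs] at h
      exact ⟨by omega, hs⟩
  have hc'y := hq'.le_of_anc hcy
  have hxc' := hxc.trans (anc_self c)
  obtain ⟨n, rfl | rfl⟩ := Nat.even_or_odd' c
  · obtain ⟨n', rfl | rfl⟩ := Nat.even_or_odd' c'
    · omega
    · obtain ⟨hs, hs0⟩ := key n' n (by omega) hq.symm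
      have hp := (IsNumTree.prevSibling_spec hs0).2
      rw [hs] at hp
      rw [show 2 * n / 2 = n by omega] at hcN
      rw [show (2 * n' + 1) / 2 = n' by omega] at hcN'
      obtain ⟨φ, hφ, hnφ, hpφ⟩ := C.exists_sibling_of_extendible_even H hcN (by omega) hce
      refine ⟨_, _, φ, n', h1, h2, hxc', hcy, ?_, hφ, C.of_extendible_odd H hcN' hce',
        by omega, hpφ.trans hp.1.symm, by omega⟩
      refine (IsNumTree.anc_even_of_sibling hcN (by omega) hpφ.symm hnφ).trans ?_
      have := anc_self (q := binParent N R) (2 * φ + 1)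
      rwa [binParent_odd] at this
  · obtain ⟨n', rfl | rfl⟩ := Nat.even_or_odd' c'
    · obtain ⟨hs, hs0⟩ := key n n' (by omega) hq
      have hp := (IsNumTree.prevSibling_spec hs0).2
      rw [hs] at hp
      rw [show (2 * n + 1) / 2 = n by omega] at hcN
      have hnE := C.of_extendible_odd H hcN hce
      exact ⟨_, _, n, n, h1, h2, hxc', hcy, Anc.refl _, hnE, hnE, by omega, rfl, by omega⟩
    · omega

/-- Along a chain with extendible nodes branching off at each step one finds incomparable nodes of
the core which have siblings in the core bounded by the chain. -/
theorem exists_antichain {x z : ℕ → ℕ} (hx : ∀ i, N (x i / 2)) (hz : ∀ i, N (z i / 2))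
    (hxe : ∀ i, {w | N (w / 2) ∧ Anc (binParent N R) (x i) w}.Infinite)
    (hze : ∀ i, {w | N (w / 2) ∧ Anc (binParent N R) (z i) w}.Infinite)
    (hxx : ∀ i, Anc (binParent N R) (x i) (x (i + 1)))
    (hxz : ∀ i, Anc (binParent N R) (x i) (z i))
    (h1 : ∀ i, ¬ Anc (binParent N R) (z i) (x (i + 1)))
    (h2 : ∀ i, ¬ Anc (binParent N R) (x (i + 1)) (z i)) :
    ∃ φ n : ℕ → ℕ, (∀ i, E (φ i) ∧ E (n i) ∧ 0 < n i ∧ parent N R (φ i) = parent N R (n i) ∧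
      n i ≤ x (i + 1)) ∧ ∀ i j, i < j → ¬ R (φ i) (φ j) ∧ ¬ R (φ j) (φ i) := by
  have hstep := fun i => C.exists_branching_core H (hx (i + 1)) (hz i) (hxe (i + 1)) (hze i)
    (hxz i) (hxx i) (h1 i) (h2 i)
  choose c c' φ n hcc hcc' hxc hcx hcφ hφ hn hn0 hp hle using hstep
  refine ⟨φ, n, fun i => ⟨hφ i, hn i, hn0 i, hp i, hle i⟩, fun i j hij => ?_⟩
  have hmono : ∀ i k, Anc (binParent N R) (x i) (x (i + k)) := by
    intro i k
    induction k with
    | zero => exact Anc.refl _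
    | succ k ih => exact ih.trans (hxx _)
  -- Every later `φ j` sits above the child `c' i` on the chain, whereas `φ i` sits above the other
  -- child `c i`.
  have hj : Anc (binParent N R) (c' i) (2 * φ j + 1) := by
    obtain ⟨k, rfl⟩ := Nat.exists_eq_add_of_le (show i + 1 ≤ j from hij)
    exact (hcx i).trans ((hmono (i + 1) k).trans ((hxc _).trans (hcφ _)))
  have key : ∀ w, Anc (binParent N R) (c i) w → Anc (binParent N R) (c' i) w → False := by
    intro w h3 h4
    rcases h3.linear h4 with h | h
    · exact hcc i h
    · exact hcc' i h
  refine ⟨fun h => ?_, fun h => ?_⟩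
  · exact key _ ((hcφ i).trans (H.anc_odd_of_rel (C.mem _ (hφ i)) (C.mem _ (hφ j)) h)) hj
  · exact key _ (hcφ i) (hj.trans (H.anc_odd_of_rel (C.mem _ (hφ j)) (C.mem _ (hφ i)) h))

end IsCore

end Core
-- The tree of stages with strings of bits
section StageTree

/-- At a first difference below `k`, `b` would exceed `a`, which equals `c` there, so `b` would
exceed `c` lexicographically. -/
theorem eq_of_lex_le_of_le {a b c : ℕ → ℕ} (hab : toLex a ≤ toLex b) (hbc : toLex b ≤ toLex c)
    {k : ℕ} (h : ∀ i < k, a i = c i) : ∀ i < k, a i = b i := by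
  intro i
  induction i using Nat.strong_induction_on with
  | _ i ih =>
    intro hi
    by_contra hne
    rcases lt_or_gt_of_ne hne with h1 | h1
    · refine hbc.not_gt ⟨i, fun j hj => ?_, ?_⟩
      · have := ih j hj (hj.trans hi)
        have := h j (hj.trans hi)
        show c j = b j
        omega
      · show c i < b i
        have := h i hi
        omega
    · exact hab.not_gt ⟨i, fun j hj => (ih j hj (hj.trans hi)).symm, h1⟩

theorem eq_of_lex_le_of_forall_ge {a b : ℕ → ℕ} (hab : toLex a ≤ toLex b)
    {k : ℕ} (h : ∀ i < k, b i ≤ a i) : ∀ i < k, a i = b i := by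
  intro i
  induction i using Nat.strong_induction_on with
  | _ i ih =>
    intro hi
    by_contra hne
    have := h i hi
    exact hab.not_gt ⟨i, fun j hj => (ih j hj (hj.trans hi)).symm, by show b i < a i; omega⟩

/-- `V` is a set of stages, the stage `s` proposing the sequence `Y s`, such that `m` is the limit
inferior of the proposals both pointwise and lexicographically. -/
structure IsApproximation (V : ℕ → Prop) (Y : ℕ → ℕ → ℕ) (m : ℕ → ℕ) : Prop where
  zero_mem : V 0
  support : ∀ s i, s ≤ i → Y s i = 0
  finite_lt : ∀ j, {s | V s ∧ Y s j < m j}.Finite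
  infinite_le : {s | V s ∧ ∀ j, Y s j ≤ m j}.Infinite

variable (V : ℕ → Prop) (Y : ℕ → ℕ → ℕ)

/-- The proposal of the stage `s` is not undercut up to the stage `t`. -/
def StageLE (s t : ℕ) : Prop :=
  s ≤ t ∧ ∀ r, s ≤ r → r ≤ t → V r → toLex (Y s) ≤ toLex (Y r)

open Classical in
/-- The length of agreement of the sequences `a` and `b`, bounded by `s`. -/
noncomputable def agreement (a b : ℕ → ℕ) (s : ℕ) : ℕ :=
  Nat.findGreatest (fun k => ∀ i < k, a i = b i) s

/-- The nodes are stages together with a string of bits. -/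
def StageNode (n : ℕ) : Prop := V n.unpair.1 ∧ n.unpair.2 < 2 ^ n.unpair.1

/-- The order of the tree of stages: the strings of bits are compatible as far as the proposals
agree, and vanish beyond. -/
def StageRel (n m : ℕ) : Prop :=
  StageLE V Y n.unpair.1 m.unpair.1 ∧
    n.unpair.2 = m.unpair.2 % 2 ^ agreement (Y n.unpair.1) (Y m.unpair.1) n.unpair.1

theorem agreement_le (a b : ℕ → ℕ) (s : ℕ) : agreement a b s ≤ s := by
  classical
  exact Nat.findGreatest_le _

theorem agreement_spec (a b : ℕ → ℕ) (s : ℕ) : ∀ i < agreement a b s, a i = b i := by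
  classical
  exact Nat.findGreatest_spec (P := fun k => ∀ i < k, a i = b i) (Nat.zero_le s)
    fun i hi => absurd hi (Nat.not_lt_zero i)

theorem le_agreement {a b : ℕ → ℕ} {k s : ℕ} (hk : k ≤ s) (h : ∀ i < k, a i = b i) :
    k ≤ agreement a b s := by
  classical
  exact Nat.le_findGreatest hk h

/-- This identity along increasing proposals makes truncation of strings compose, hence `StageRel`
transitive and the predecessors of a node comparable. -/
theorem agreement_eq_min {a b c : ℕ → ℕ} {s t : ℕ} (hst : s ≤ t) (hab : toLex a ≤ toLex b)
    (hbc : toLex b ≤ toLex c) :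
    agreement a c s = min (agreement a b s) (agreement b c t) := by
  have h1 := agreement_spec a c s
  have h2 := eq_of_lex_le_of_le hab hbc h1
  refine le_antisymm (le_min (le_agreement (agreement_le _ _ _) h2) ?_) ?_
  · exact le_agreement ((agreement_le _ _ _).trans hst) fun i hi => (h2 i hi).symm.trans (h1 i hi)
  · refine le_agreement ((min_le_left _ _).trans (agreement_le _ _ _)) fun i hi => ?_
    exact (agreement_spec a b s i (hi.trans_le (min_le_left _ _))).trans
      (agreement_spec b c t i (hi.trans_le (min_le_right _ _)))

theorem agreement_self (a : ℕ → ℕ) (s : ℕ) : agreement a a s = s :=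
  le_antisymm (agreement_le _ _ _) (le_agreement le_rfl fun _ _ => rfl)

theorem mod_two_pow_mod_two_pow (x a b : ℕ) : x % 2 ^ a % 2 ^ b = x % 2 ^ min b a := by
  rcases le_total a b with h | h
  · rw [min_eq_right h]
    exact Nat.mod_eq_of_lt ((Nat.mod_lt _ (by positivity)).trans_le
      (Nat.pow_le_pow_right (by norm_num) h))
  · rw [min_eq_left h]
    exact Nat.mod_mod_of_dvd _ (pow_dvd_pow 2 h)

theorem pair_le_pair {a b c d : ℕ} (h : a ≤ c) (h' : b ≤ d) : Nat.pair a b ≤ Nat.pair c d := by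
  refine le_trans (b := Nat.pair c b) ?_ ?_
  · exact (strictMono_nat_of_lt_succ fun a =>
      Nat.pair_lt_pair_left b (Nat.lt_succ_self a)).monotone h
  · exact (strictMono_nat_of_lt_succ fun b =>
      Nat.pair_lt_pair_right c (Nat.lt_succ_self b)).monotone h'

variable {V Y} {m : ℕ → ℕ}

theorem finite_of_stage_bounded (r : ℕ) {A : Set ℕ}
    (h : ∀ n ∈ A, StageNode V n ∧ n.unpair.1 ≤ r) : A.Finite := by
  refine (Set.finite_Iic (Nat.pair r (2 ^ r))).subset fun n hn => ?_
  obtain ⟨h1, h2⟩ := h n hn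
  rw [Set.mem_Iic, ← Nat.pair_unpair n]
  exact pair_le_pair h2 (h1.2.le.trans (Nat.pow_le_pow_right (by norm_num) h2))

namespace IsApproximation

variable (A : IsApproximation V Y m)
include A

theorem isNumTree : IsNumTree (StageNode V) (StageRel V Y) := by
  refine ⟨?_, ?_, ?_, ?_, ?_, ?_⟩
  · refine ⟨?_, ?_⟩ <;> simp [A.zero_mem]
  · intro n _
    refine ⟨⟨?_, fun r _ _ _ => ?_⟩, ?_⟩
    · simp
    · refine Pi.toLex_monotone fun i => ?_
      have h0 : (Nat.unpair 0).1 = 0 := by simp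
      rw [h0, A.support 0 i (Nat.zero_le i)]
      exact Nat.zero_le _
    · have h0 : (Nat.unpair 0).1 = 0 := by simp
      have h0' : (Nat.unpair 0).2 = 0 := by simp
      rw [h0, h0', Nat.le_zero.1 (agreement_le _ _ 0), pow_zero, Nat.mod_one]
  · intro n hn
    refine ⟨⟨le_rfl, fun r h1 h2 _ => ?_⟩, ?_⟩
    · rw [le_antisymm h1 h2]
    · rw [agreement_self, Nat.mod_eq_of_lt hn.2]
  · rintro k m n hk hm hn ⟨⟨h1, h2⟩, h3⟩ ⟨⟨h4, h5⟩, h6⟩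
    have hkm := h2 _ h1 le_rfl hm.1
    refine ⟨⟨h1.trans h4, fun r hr hr' hV => ?_⟩, ?_⟩
    · rcases le_total r m.unpair.1 with h | h
      · exact h2 r hr h hV
      · exact hkm.trans (h5 r h hr' hV)
    · rw [h3, h6, mod_two_pow_mod_two_pow, agreement_eq_min h1 hkm (h5 _ h4 le_rfl hn.1)]
  · rintro m n ⟨⟨h1, -⟩, h2⟩
    rw [← Nat.pair_unpair m, ← Nat.pair_unpair n]
    exact pair_le_pair h1 (h2 ▸ Nat.mod_le _ _)
  · rintro k m n hk hm hn ⟨⟨h1, h2⟩, h3⟩ ⟨⟨h4, h5⟩, h6⟩ hle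
    have hs : k.unpair.1 ≤ m.unpair.1 ∨ (k.unpair.1 = m.unpair.1 ∨ m.unpair.1 < k.unpair.1) := by
      omega
    have key : ∀ k m, StageNode V k → StageNode V m → StageRel V Y k n → StageRel V Y m n →
        k.unpair.1 ≤ m.unpair.1 → StageRel V Y k m := by
      rintro k m hk hm ⟨⟨h1, h2⟩, h3⟩ ⟨⟨h4, h5⟩, h6⟩ hle
      refine ⟨⟨hle, fun r hr hr' hV => h2 r hr (hr'.trans h4) hV⟩, ?_⟩
      rw [h3, h6, mod_two_pow_mod_two_pow,
        agreement_eq_min hle (h2 _ hle h4 hm.1) (h5 _ h4 le_rfl hn.1)]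
    rcases le_or_gt k.unpair.1 m.unpair.1 with h | h
    · exact key k m hk hm ⟨⟨h1, h2⟩, h3⟩ ⟨⟨h4, h5⟩, h6⟩ h
    · have h7 := key m k hm hk ⟨⟨h4, h5⟩, h6⟩ ⟨⟨h1, h2⟩, h3⟩ h.le
      have h8 : m ≤ k := by
        rw [← Nat.pair_unpair m, ← Nat.pair_unpair k]
        exact pair_le_pair h.le (h7.2 ▸ Nat.mod_le _ _)
      rw [le_antisymm h8 hle] at h
      exact absurd h (lt_irrefl _)

omit A in
variable (V Y) in
/-- The stages whose proposal is never undercut later. -/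
def TrueStage (t : ℕ) : Prop := V t ∧ ∀ r, t ≤ r → V r → toLex (Y t) ≤ toLex (Y r)

omit A in
variable (V Y m) in
/-- The infinite part of the tree of stages. -/
def StageCore (n : ℕ) : Prop :=
  TrueStage V Y n.unpair.1 ∧ n.unpair.2 < 2 ^ agreement (Y n.unpair.1) m n.unpair.1

theorem exists_good_stage (s : ℕ) : ∃ r, s ≤ r ∧ V r ∧ toLex (Y r) ≤ toLex m := by
  obtain ⟨r, hr, hsr⟩ := A.infinite_le.exists_gt s
  exact ⟨r, hsr.le, hr.1, Pi.toLex_monotone hr.2⟩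

theorem le_of_trueStage {t : ℕ} (ht : TrueStage V Y t) : toLex (Y t) ≤ toLex m := by
  obtain ⟨r, h1, h2, h3⟩ := A.exists_good_stage t
  exact (ht.2 r h1 h2).trans h3

/-- If some proposal from `s` on is lexicographically below `m`, only finitely many are at most that
one, since they must undercut `m` at one of finitely many coordinates; a least of them is never
undercut later. Otherwise every proposal from `s` on is at least `m`, and a stage proposing at most
`m` is true. -/
theorem exists_trueStage_ge (s : ℕ) : ∃ t, s ≤ t ∧ TrueStage V Y t := by
  obtain ⟨r, h1, h2, h3⟩ := A.exists_good_stage s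
  by_cases hlt : ∃ r, s ≤ r ∧ V r ∧ toLex (Y r) < toLex m
  · obtain ⟨r, h1, h2, h3⟩ := hlt
    have hfin : {q | s ≤ q ∧ V q ∧ toLex (Y q) ≤ toLex (Y r)}.Finite := by
      obtain ⟨i, hi, hlt⟩ := h3
      have : (⋃ j ∈ Set.Iic i, {q | V q ∧ Y q j < m j}).Finite :=
        (Set.finite_Iic i).biUnion fun j _ => A.finite_lt j
      refine this.subset fun q hq => ?_
      by_contra hn
      simp only [Set.mem_iUnion, Set.mem_Iic, Set.mem_ofPred_eq, not_exists, not_and,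
        not_lt] at hn
      have hq' := eq_of_lex_le_of_forall_ge hq.2.2 (k := i) fun j hj => by
        have := hn j hj.le hq.2.1
        have h5 : Y r j = m j := hi j hj
        omega
      refine hq.2.2.not_gt ⟨i, fun j hj => (hq' j hj).symm, ?_⟩
      have h6 : Y r i < m i := hlt
      exact h6.trans_le (hn i le_rfl hq.2.1)
    obtain ⟨t, ht, hmin⟩ := hfin.exists_minimalFor (fun q => toLex (Y q)) _ ⟨r, h1, h2, le_rfl⟩
    refine ⟨t, ht.1, ht.2.1, fun q htq hq => ?_⟩
    rcases le_total (toLex (Y t)) (toLex (Y q)) with h | h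
    · exact h
    · exact hmin ⟨ht.1.trans htq, hq, h.trans ht.2.2⟩ h
  · push Not at hlt
    exact ⟨r, h1, h2, fun q hrq hq => h3.trans (not_lt.1 (hlt q (h1.trans hrq) hq))⟩

theorem exists_trueStage_agreement (s k : ℕ) :
    ∃ t, s ≤ t ∧ TrueStage V Y t ∧ k ≤ agreement (Y t) m t := by
  have : (⋃ j ∈ Set.Iio k, {q | V q ∧ Y q j < m j}).Finite :=
    (Set.finite_Iio k).biUnion fun j _ => A.finite_lt j
  obtain ⟨b, hb⟩ := this.bddAbove
  -- Beyond `b` no stage undercuts `m` at a coordinate below `k`, while a true stage is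
  -- lexicographically at most `m`. The summand `k` is needed because agreement at `t` is capped by
  -- `t`.
  obtain ⟨t, ht, hT⟩ := A.exists_trueStage_ge (s + k + b + 1)
  refine ⟨t, by omega, hT, le_agreement (by omega) ?_⟩
  refine eq_of_lex_le_of_forall_ge (A.le_of_trueStage hT) fun j hj => ?_
  by_contra hlt
  have h1 := hb (Set.mem_biUnion (show j ∈ Set.Iio k from hj) ⟨hT.1, not_le.1 hlt⟩)
  omega

omit A in
-- A prefix common to `Y t` and `a` is shared by `Y t'`, which lies between them. If it were longer
-- than the agreement of `Y t` with `m`, the better agreement of `Y t'` would carry it over to `m`.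
theorem agreement_le_of_trueStage {t t' : ℕ} {a : ℕ → ℕ}
    (htt' : toLex (Y t) ≤ toLex (Y t')) (hta : toLex (Y t') ≤ toLex a)
    (h : agreement (Y t) m t < agreement (Y t') m t') :
    agreement (Y t) a t ≤ agreement (Y t) m t := by
  by_contra hlt
  have h1 := eq_of_lex_le_of_le htt' hta (agreement_spec (Y t) a t)
  have h2 : agreement (Y t) m t + 1 ≤ agreement (Y t) m t := by
    refine le_agreement ((not_le.1 hlt).trans_le (agreement_le _ _ _)) fun i hi => ?_
    exact (h1 i (by omega)).trans (agreement_spec (Y t') m t' i (by omega))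
  omega

theorem le_agreement_of_trueStage {t u : ℕ} (ht : TrueStage V Y t) (hu : TrueStage V Y u)
    (htu : t ≤ u) : agreement (Y t) m t ≤ agreement (Y t) (Y u) t :=
  le_agreement (agreement_le _ _ _) (eq_of_lex_le_of_le (ht.2 u htu hu.1)
    (A.le_of_trueStage hu) (agreement_spec _ _ _))

omit A in
theorem stageLE_of_trueStage {t u : ℕ} (ht : TrueStage V Y t) (htu : t ≤ u) : StageLE V Y t u :=
  ⟨htu, fun r hr _ hV => ht.2 r hr hV⟩

/-- A later true proposal lies between the earlier one and `m`, so it agrees with the earlier one at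
least as far as `m` does, and truncation leaves the string unchanged. The pigeonhole argument rests
on this. -/
theorem rel_of_eq {n k : ℕ} (hn : StageCore V Y m n) (hk : StageCore V Y m k)
    (h : n.unpair.2 = k.unpair.2) (hle : n.unpair.1 ≤ k.unpair.1) : StageRel V Y n k := by
  refine ⟨stageLE_of_trueStage hn.1 hle, ?_⟩
  rw [← h]
  refine (Nat.mod_eq_of_lt (hn.2.trans_le ?_)).symm
  exact Nat.pow_le_pow_right (by norm_num) (A.le_agreement_of_trueStage hn.1 hk.1 hle)

omit A in
/-- The predecessor at a true stage of a later node. -/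
theorem exists_rel_at_trueStage {u n : ℕ} (hu : TrueStage V Y u) (hle : u ≤ n.unpair.1) :
    ∃ k, StageNode V k ∧ k.unpair.1 = u ∧ StageRel V Y k n := by
  refine ⟨Nat.pair u (n.unpair.2 % 2 ^ agreement (Y u) (Y n.unpair.1) u), ⟨?_, ?_⟩, ?_, ?_, ?_⟩
  · simpa using hu.1
  · simp only [Nat.unpair_pair]
    exact (Nat.mod_lt _ (by positivity)).trans_le
      (Nat.pow_le_pow_right (by norm_num) (agreement_le _ _ _))
  · simp
  · simpa using stageLE_of_trueStage hu hle
  · simp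

/-- A node after the true stage `u` has a predecessor at stage `u`, so its parent cannot lie before
`u`. -/
theorem stage_le_of_parent {u n k : ℕ} (hu : TrueStage V Y u) (hn : StageNode V n)
    (h : parent (StageNode V) (StageRel V Y) n = k) (hk : k.unpair.1 < u) :
    n.unpair.1 ≤ u := by
  by_contra hlt
  obtain ⟨l, hl, hlu, hln⟩ := exists_rel_at_trueStage hu (not_le.1 hlt).le
  have := A.isNumTree.rel_parent hl hn hln (fun h => by rw [h] at hlu; omega)
  rw [h] at this
  have := this.1.1
  omega

theorem isCore : IsCore (StageNode V) (StageRel V Y) (StageCore V Y m) := by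
  refine ⟨?_, ?_, ?_, ?_, ?_⟩
  · rintro n ⟨h1, h2⟩
    exact ⟨h1.1, h2.trans_le (Nat.pow_le_pow_right (by norm_num) (agreement_le _ _ _))⟩
  · obtain ⟨t, -, ht⟩ := A.exists_trueStage_ge 0
    refine ⟨Nat.pair t 0, ?_, ?_⟩ <;> simp [ht]
  · intro n hn hnE
    by_cases ht : TrueStage V Y n.unpair.1
    -- Nodes beyond a true stage of better agreement with `m` agree with the stage of `n` at most as
    -- far as `m` does, so a string too long for the core does not survive there.
    · obtain ⟨u, hu, huT, hag⟩ := A.exists_trueStage_agreement n.unpair.1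
        (agreement (Y n.unpair.1) m n.unpair.1 + 1)
      refine finite_of_stage_bounded u fun k hk => ⟨hk.1, ?_⟩
      by_contra hlt
      refine hnE ⟨ht, ?_⟩
      rw [hk.2.2]
      refine (Nat.mod_lt _ (by positivity)).trans_le (Nat.pow_le_pow_right (by norm_num) ?_)
      exact agreement_le_of_trueStage (ht.2 u hu huT.1) (huT.2 _ (not_le.1 hlt).le hk.1.1) hag
    · have : ∃ r, n.unpair.1 ≤ r ∧ V r ∧ ¬ toLex (Y n.unpair.1) ≤ toLex (Y r) := by
        by_contra! h
        exact ht ⟨hn.1, h⟩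
      obtain ⟨r, h1, h2, h3⟩ := this
      refine finite_of_stage_bounded r fun k hk => ⟨hk.1, ?_⟩
      by_contra hlt
      exact h3 (hk.2.1.2 r h1 (not_le.1 hlt).le h2)
  · intro n hn
    obtain ⟨u, hu, huT⟩ := A.exists_trueStage_ge (n.unpair.1 + 1)
    exact finite_of_stage_bounded u fun k hk =>
      ⟨hk.1, A.stage_le_of_parent huT hk.1 hk.2 hu⟩
  · intro n hn
    -- Longer agreement with `m` frees a bit just beyond the string of `n`; leaving it unset or
    -- setting it gives the two incomparable core nodes.
    obtain ⟨u, hu, huT, hag⟩ := A.exists_trueStage_agreement n.unpair.1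
      (agreement (Y n.unpair.1) m n.unpair.1 + 1)
    have hle := hn.1.2 u hu huT.1
    have heq : agreement (Y n.unpair.1) (Y u) n.unpair.1 = agreement (Y n.unpair.1) m n.unpair.1 :=
      le_antisymm (agreement_le_of_trueStage hle le_rfl hag)
        (A.le_agreement_of_trueStage hn.1 huT hu)
    have hpow := Nat.pow_le_pow_right (n := 2) (by norm_num) hag
    rw [pow_succ] at hpow
    have h2 := hn.2
    have hinc : ∀ σ τ, StageRel V Y (Nat.pair u σ) (Nat.pair u τ) →
        τ < 2 ^ agreement (Y u) m u → σ = τ := by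
      rintro σ τ ⟨-, h⟩ hτ
      simp only [Nat.unpair_pair, agreement_self] at h
      rw [h, Nat.mod_eq_of_lt]
      exact hτ.trans_le (Nat.pow_le_pow_right (by norm_num) (agreement_le _ _ _))
    have hpos : 0 < 2 ^ agreement (Y n.unpair.1) m n.unpair.1 := by positivity
    refine ⟨Nat.pair u n.unpair.2,
      Nat.pair u (n.unpair.2 + 2 ^ agreement (Y n.unpair.1) m n.unpair.1), ⟨?_, ?_⟩, ⟨?_, ?_⟩,
      ⟨?_, ?_⟩, ⟨?_, ?_⟩, fun h => ?_, fun h => ?_⟩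
    · simpa using huT
    · simp only [Nat.unpair_pair]; omega
    · simpa using huT
    · simp only [Nat.unpair_pair]; omega
    · simpa using stageLE_of_trueStage hn.1 hu
    · simp only [Nat.unpair_pair, heq]
      rw [Nat.mod_eq_of_lt h2]
    · simpa using stageLE_of_trueStage hn.1 hu
    · simp only [Nat.unpair_pair, heq]
      rw [Nat.add_mod_right, Nat.mod_eq_of_lt h2]
    · have := hinc _ _ h (by omega)
      omega
    · have := hinc _ _ h (by omega)
      omega

/-- The stage of `n` is true and the common parent lies at an earlier stage, since a parent at the
same stage would coincide with `n`. -/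
theorem stage_le_of_sibling {φ n : ℕ} (hφ : StageCore V Y m φ) (hn : StageCore V Y m n)
    (hn0 : 0 < n)
    (h : parent (StageNode V) (StageRel V Y) φ = parent (StageNode V) (StageRel V Y) n) :
    φ.unpair.1 ≤ n.unpair.1 := by
  refine A.stage_le_of_parent hn.1 (A.isCore.mem φ hφ) h ?_
  obtain ⟨h1, h2⟩ := A.isNumTree.parent_spec (A.isCore.mem n hn)
  refine lt_of_le_of_ne h2.1.1 fun he => ?_
  have h3 := h2.2
  rw [he, agreement_self, Nat.mod_eq_of_lt (A.isCore.mem n hn).2] at h3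
  refine (IsNumTree.parent_lt (N := StageNode V) (R := StageRel V Y) hn0).ne ?_
  rw [← Nat.pair_unpair (parent (StageNode V) (StageRel V Y) n), he, h3, Nat.pair_unpair]

/-- The nodes of an increasing sequence of the binary tree that is left by extendible nodes at each
step bound stages that agree with the limit far enough. -/
theorem exists_agreeing_stage
    {x z : ℕ → BinTree (StageNode V) (StageRel V Y)}
    (hze : ∀ i, Extendible (z i)) (hxx : ∀ i, x i < x (i + 1)) (hxz : ∀ i, x i ≤ z i)
    (h1 : ∀ i, ¬ z i ≤ x (i + 1)) (h2 : ∀ i, ¬ x (i + 1) ≤ z i) (k : ℕ) :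
    ∃ u ≤ (x (2 ^ k + 1)).code, ∀ i ≤ k, Y u i = m i := by
  obtain ⟨φ, n, hφ, hinc⟩ := A.isCore.exists_antichain A.isNumTree
    (x := fun i => (x i).code) (z := fun i => (z i).code)
    (fun i => (x i).code_mem) (fun i => (z i).code_mem)
    (fun i => BinTree.extendible_iff.1 ((hze i).mono (hxz i)))
    (fun i => BinTree.extendible_iff.1 (hze i))
    (fun i => (hxx i).le) hxz h1 h2
  by_contra! hcon
  have hmono : Monotone fun i => (x i).code :=
    monotone_nat_of_le_succ fun i => IsNumTree.isParentFun.le_of_anc (hxx i).le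
  -- If no stage in range agrees with `m` on `0, …, k`, all these agreements are at most `k`. Then
  -- `2 ^ k + 1` incomparable nodes have strings below `2 ^ k`, and two with the same string are
  -- comparable.
  have hlt : ∀ i < 2 ^ k + 1, (φ i).unpair.2 < 2 ^ k := by
    intro i hi
    obtain ⟨hφE, hnE, hn0, hp, hle⟩ := hφ i
    have hu : (φ i).unpair.1 ≤ (x (2 ^ k + 1)).code :=
      ((A.stage_le_of_sibling hφE hnE hn0 hp).trans (Nat.unpair_left_le _)).trans
        (hle.trans (hmono hi))
    obtain ⟨j, hj, hne⟩ := hcon _ hu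
    refine hφE.2.trans_le (Nat.pow_le_pow_right (by norm_num) ?_)
    by_contra hlt
    exact hne (agreement_spec _ _ (φ i).unpair.1 j (by omega))
  have hinj : Set.InjOn (fun i => (φ i).unpair.2) (Finset.range (2 ^ k + 1) : Set ℕ) := by
    have key : ∀ i j, i < j → (φ i).unpair.2 ≠ (φ j).unpair.2 := by
      intro i j hij he
      rcases le_total (φ i).unpair.1 (φ j).unpair.1 with h | h
      · exact (hinc i j hij).1 (A.rel_of_eq (hφ i).1 (hφ j).1 he h)
      · exact (hinc i j hij).2 (A.rel_of_eq (hφ j).1 (hφ i).1 he.symm h)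
    intro i _ j _ he
    rcases lt_trichotomy i j with h | h | h
    · exact absurd he (key i j h)
    · exact h
    · exact absurd he.symm (key j i h)
  have hcard := Finset.card_le_card_of_injOn (s := Finset.range (2 ^ k + 1))
    (t := Finset.range (2 ^ k)) (fun i => (φ i).unpair.2)
    (fun i hi => Finset.mem_coe.2 (Finset.mem_range.2 (hlt i (by simpa using hi)))) hinj
  simp at hcard

end IsApproximation

end StageTree
-- Primitive recursiveness of the trees
section PrimrecTools

variable {α : Type*} [Primcodable α]

theorem primrecPred_exists_lt {p : α → ℕ → Prop} {f : α → ℕ} (hp : PrimrecRel p)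
    (hf : Primrec f) : PrimrecPred fun a => ∃ i < f a, p a i := by
  have : PrimrecRel fun (i : ℕ) (a : α) => p a i := PrimrecRel.comp hp Primrec.snd Primrec.fst
  refine (PrimrecRel.comp this.exists_mem_list (Primrec.list_range.comp hf) Primrec.id).of_eq ?_
  simp

theorem primrecPred_forall_lt {p : α → ℕ → Prop} {f : α → ℕ} (hp : PrimrecRel p)
    (hf : Primrec f) : PrimrecPred fun a => ∀ i < f a, p a i := by
  have : PrimrecRel fun (i : ℕ) (a : α) => p a i := PrimrecRel.comp hp Primrec.snd Primrec.fst
  refine (PrimrecRel.comp this.forall_mem_list (Primrec.list_range.comp hf) Primrec.id).of_eq ?_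
  simp

theorem primrecPred_imp {p q : α → Prop} (hp : PrimrecPred p) (hq : PrimrecPred q) :
    PrimrecPred fun a => p a → q a :=
  (hp.not.or hq).of_eq fun _ => imp_iff_not_or.symm

theorem primrec_findGreatest {p : α → ℕ → Prop} {_ : ∀ a, DecidablePred (p a)} {f : α → ℕ}
    (hp : PrimrecRel p) (hf : Primrec f) : Primrec fun a => Nat.findGreatest (p a) (f a) := by
  have : DecidableRel p := fun a => inferInstance
  refine (Primrec.nat_findGreatest hf hp).of_eq fun a => ?_
  congr

theorem primrec_two_pow {f : α → ℕ} (hf : Primrec f) : Primrec fun a => 2 ^ f a :=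
  (Primrec₂.unpaired'.1 Nat.Primrec.pow).comp (Primrec.const 2) hf

theorem PrimrecPred.computablePred {p : α → Prop} (hp : PrimrecPred p) : ComputablePred p := by
  obtain ⟨i, hi⟩ := hp
  exact ⟨i, hi.to_comp⟩

end PrimrecTools

section BinComputable

variable {N : ℕ → Prop} {R : ℕ → ℕ → Prop}

theorem primrec_parent (hN : PrimrecPred N) (hR : PrimrecRel R) : Primrec (parent N R) := by
  refine primrec_findGreatest (p := fun m k => N k ∧ R k m) ?_ ?_
  · exact (hN.comp Primrec.snd).and (hR.comp Primrec.snd Primrec.fst)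
  · exact Primrec.nat_sub.comp Primrec.id (Primrec.const 1)

theorem primrec_prevSibling (hN : PrimrecPred N) (hR : PrimrecRel R) :
    Primrec (prevSibling N R) := by
  have hp := primrec_parent hN hR
  refine primrec_findGreatest (p := fun m k => N k ∧ 0 < k ∧ parent N R k = parent N R m) ?_ ?_
  · exact (hN.comp Primrec.snd).and ((Primrec.nat_lt.comp (Primrec.const 0) Primrec.snd).and
      (Primrec.eq.comp (hp.comp Primrec.snd) (hp.comp Primrec.fst)))
  · exact Primrec.nat_sub.comp Primrec.id (Primrec.const 1)

theorem primrec_half : Primrec fun x : ℕ => x / 2 :=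
  Primrec.nat_div.comp Primrec.id (Primrec.const 2)

theorem primrec_binParent (hN : PrimrecPred N) (hR : PrimrecRel R) :
    Primrec (binParent N R) := by
  have hp := (primrec_parent hN hR).comp primrec_half
  have hs := (primrec_prevSibling hN hR).comp primrec_half
  refine Primrec.ite (Primrec.eq.comp (Primrec.nat_mod.comp Primrec.id (Primrec.const 2))
    (Primrec.const 1)) (Primrec.nat_sub.comp Primrec.id (Primrec.const 1)) ?_
  refine Primrec.ite (Primrec.eq.comp Primrec.id (Primrec.const 0)) (Primrec.const 0) ?_
  refine Primrec.ite (Primrec.eq.comp hs (Primrec.const 0)) ?_ ?_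
  · exact Primrec.nat_double_succ.comp hp
  · exact Primrec.nat_double.comp hs

/-- Parents decrease strictly until `0`, where the iteration stays, so `y` steps exhaust the
ancestors of `y`. -/
theorem anc_iff_exists_lt {q : ℕ → ℕ} (hq : IsParentFun q) {x y : ℕ} :
    Anc q x y ↔ ∃ j < y + 1, q^[j] y = x := by
  refine ⟨?_, fun ⟨j, _, h⟩ => ⟨j, h⟩⟩
  rintro ⟨j, rfl⟩
  have hfix : ∀ k, q^[k] 0 = 0 := fun k => Function.iterate_fixed hq.zero k
  have hlt : ∀ j, q^[j] y ≤ y - j := by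
    intro j
    induction j with
    | zero => exact le_rfl
    | succ j ih =>
      rw [Function.iterate_succ_apply']
      rcases Nat.eq_zero_or_pos (q^[j] y) with h | h
      · rw [h, hq.zero]; exact Nat.zero_le _
      · have := hq.lt _ h
        omega
  rcases lt_or_ge j (y + 1) with h | h
  · exact ⟨j, h, rfl⟩
  · refine ⟨y, Nat.lt_succ_self y, ?_⟩
    have h1 := hlt y
    have h2 := hlt j
    omega

theorem isComputablePresentation (hN : PrimrecPred N) (hR : PrimrecRel R) :
    IsComputablePresentation (BinNode N) (binLE N R) := by
  have hmem : PrimrecPred fun n : ℕ => n ∈ BinNode N := hN.comp primrec_half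
  have hq := primrec_binParent hN hR
  refine ⟨hmem.computablePred, PrimrecPred.computablePred ?_⟩
  have hanc : PrimrecPred fun p : ℕ × ℕ => ∃ j < p.2 + 1, (binParent N R)^[j] p.2 = p.1 := by
    refine primrecPred_exists_lt (p := fun (p : ℕ × ℕ) j => (binParent N R)^[j] p.2 = p.1) ?_
      (Primrec.succ.comp Primrec.snd)
    refine Primrec.eq.comp ?_ (Primrec.fst.comp Primrec.fst)
    exact Primrec.nat_iterate Primrec.snd (Primrec.snd.comp Primrec.fst) (hq.comp Primrec.snd).to₂
  refine ((hmem.comp Primrec.fst).and ((hmem.comp Primrec.snd).and hanc)).of_eq fun p => ?_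
  rw [← anc_iff_exists_lt IsNumTree.isParentFun]
  constructor
  · rintro ⟨h1, h2, h3⟩
    exact ⟨h1, h2, h3⟩
  · rintro ⟨h1, h2, h3⟩
    exact ⟨h1, h2, h3⟩

end BinComputable

section StageComputable

variable {V : ℕ → Prop} {Y : ℕ → ℕ → ℕ}

/-- A place where `Y r` undercuts `Y s` is one where `Y s` is positive, hence below `s`; this makes
the comparison a bounded search. -/
theorem lex_le_iff_of_support (hY0 : ∀ s i, s ≤ i → Y s i = 0) (s r : ℕ) :
    toLex (Y s) ≤ toLex (Y r) ↔ ¬ ∃ i < s, Y r i < Y s i ∧ ∀ j < i, Y r j = Y s j := by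
  rw [← not_lt, not_iff_not]
  constructor
  · rintro ⟨i, h1, h2⟩
    refine ⟨i, ?_, h2, h1⟩
    by_contra h
    have h3 : Y r i < Y s i := h2
    rw [hY0 s i (not_lt.1 h)] at h3
    exact absurd h3 (Nat.not_lt_zero _)
  · rintro ⟨i, -, h2, h1⟩
    exact ⟨i, h1, h2⟩

theorem primrecRel_stageLE (hV : PrimrecPred V) (hY : Primrec₂ Y)
    (hY0 : ∀ s i, s ≤ i → Y s i = 0) : PrimrecRel (StageLE V Y) := by
  have hlex : PrimrecPred fun p : ℕ × ℕ => toLex (Y p.1) ≤ toLex (Y p.2) := by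
    refine (PrimrecPred.not ?_).of_eq fun p => (lex_le_iff_of_support hY0 p.1 p.2).symm
    refine primrecPred_exists_lt
      (p := fun (p : ℕ × ℕ) i => Y p.2 i < Y p.1 i ∧ ∀ j < i, Y p.2 j = Y p.1 j) ?_ Primrec.fst
    refine (Primrec.nat_lt.comp (hY.comp (Primrec.snd.comp Primrec.fst) Primrec.snd)
      (hY.comp (Primrec.fst.comp Primrec.fst) Primrec.snd)).and ?_
    refine primrecPred_forall_lt
      (p := fun (p : (ℕ × ℕ) × ℕ) j => Y p.1.2 j = Y p.1.1 j) ?_ Primrec.snd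
    have h1 : Primrec fun x : ((ℕ × ℕ) × ℕ) × ℕ => x.1.1 := Primrec.fst.comp Primrec.fst
    exact Primrec.eq.comp (hY.comp (Primrec.snd.comp h1) Primrec.snd)
      (hY.comp (Primrec.fst.comp h1) Primrec.snd)
  have hall : PrimrecPred fun p : ℕ × ℕ =>
      ∀ r < p.2 + 1, p.1 ≤ r → V r → toLex (Y p.1) ≤ toLex (Y r) := by
    refine primrecPred_forall_lt
      (p := fun (p : ℕ × ℕ) r => p.1 ≤ r → V r → toLex (Y p.1) ≤ toLex (Y r)) ?_
      (Primrec.succ.comp Primrec.snd)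
    refine primrecPred_imp (Primrec.nat_le.comp (Primrec.fst.comp Primrec.fst) Primrec.snd)
      (primrecPred_imp (hV.comp Primrec.snd) ?_)
    exact hlex.comp ((Primrec.fst.comp Primrec.fst).pair Primrec.snd)
  refine (Primrec.nat_le.and hall).of_eq fun p => and_congr_right fun _ => ?_
  exact ⟨fun h r h1 h2 => h r (Nat.lt_succ_of_le h2) h1,
    fun h r h1 h2 => h r h2 (Nat.le_of_lt_succ h1)⟩

theorem primrecPred_stageNode (hV : PrimrecPred V) : PrimrecPred (StageNode V) :=
  (hV.comp (Primrec.fst.comp Primrec.unpair)).and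
    (Primrec.nat_lt.comp (Primrec.snd.comp Primrec.unpair)
      (primrec_two_pow (Primrec.fst.comp Primrec.unpair)))

theorem primrecRel_stageRel (hV : PrimrecPred V) (hY : Primrec₂ Y)
    (hY0 : ∀ s i, s ≤ i → Y s i = 0) : PrimrecRel (StageRel V Y) := by
  have hag : Primrec fun p : ℕ × ℕ => agreement (Y p.1) (Y p.2) p.1 := by
    refine primrec_findGreatest (p := fun (p : ℕ × ℕ) k => ∀ i < k, Y p.1 i = Y p.2 i) ?_
      Primrec.fst
    refine primrecPred_forall_lt
      (p := fun (p : (ℕ × ℕ) × ℕ) j => Y p.1.1 j = Y p.1.2 j) ?_ Primrec.snd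
    have h1 : Primrec fun x : ((ℕ × ℕ) × ℕ) × ℕ => x.1.1 := Primrec.fst.comp Primrec.fst
    exact Primrec.eq.comp (hY.comp (Primrec.fst.comp h1) Primrec.snd)
      (hY.comp (Primrec.snd.comp h1) Primrec.snd)
  have hn1 : Primrec fun p : ℕ × ℕ => p.1.unpair := Primrec.unpair.comp Primrec.fst
  have hn2 : Primrec fun p : ℕ × ℕ => p.2.unpair := Primrec.unpair.comp Primrec.snd
  have hs1 := Primrec.fst.comp hn1
  have hs2 := Primrec.fst.comp hn2
  refine ((primrecRel_stageLE hV hY hY0).comp hs1 hs2).and ?_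
  exact Primrec.eq.comp (Primrec.snd.comp hn1) (Primrec.nat_mod.comp (Primrec.snd.comp hn2)
    (primrec_two_pow (hag.comp (hs1.pair hs2))))

end StageComputable
-- Approximating least witnesses of Σ₂ statements
section Witness

/-- The `i`-th of a sequence of `Σ₂` statements `∃ w, ∀ u, W i w u`. -/
def Sigma2 (W : ℕ → ℕ → ℕ → Prop) (i : ℕ) : Prop := ∃ w, ∀ u, W i w u

variable (W : ℕ → ℕ → ℕ → Prop)

open Classical in
/-- The least candidate for a witness that is not refuted at stage `s`. -/
noncomputable def candidate (i s : ℕ) : ℕ :=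
  Nat.findGreatest (fun n => ∀ w < n, ∃ u < s + 1, ¬ W i w u) s

open Classical in
/-- The least witness plus one, or `0` if there is none. -/
noncomputable def leastWitness (i : ℕ) : ℕ :=
  if h : Sigma2 W i then Nat.find h + 1 else 0

/-- The `i`-th binary digit of `I` is one. -/
def HasBit (I i : ℕ) : Prop := I / 2 ^ i % 2 = 1

/-- Each statement with index in `I` below `c` has `c` candidates refuted at the stage `u`. -/
def Ready (I c u : ℕ) : Prop := ∀ i < c, HasBit I i → c ≤ candidate W i u

/-- The stages are triples `(I, c, u)` such that `I` is a set of indices below `c` and `u` is the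
first stage for which `I` and `c` are ready. -/
def GuessStage (t : ℕ) : Prop :=
  t.unpair.1.unpair.1 < 2 ^ t.unpair.1.unpair.2 ∧
    Ready W t.unpair.1.unpair.1 t.unpair.1.unpair.2 t.unpair.2 ∧
    ∀ u < t.unpair.2, ¬ Ready W t.unpair.1.unpair.1 t.unpair.1.unpair.2 u

open Classical in
/-- The guess of a stage `(I, c, u)` about the least witnesses of the statements below `c`, where
those in `I` are taken to be false. -/
noncomputable def guess (t i : ℕ) : ℕ :=
  if i < t.unpair.1.unpair.2 ∧ ¬ HasBit t.unpair.1.unpair.1 i then candidate W i t + 1 else 0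

variable {W}

theorem candidate_le (i s : ℕ) : candidate W i s ≤ s := by
  classical
  exact Nat.findGreatest_le _

theorem candidate_spec (i s : ℕ) : ∀ w < candidate W i s, ∃ u < s + 1, ¬ W i w u := by
  classical
  exact Nat.findGreatest_spec (P := fun n => ∀ w < n, ∃ u < s + 1, ¬ W i w u) (Nat.zero_le s)
    fun w hw => absurd hw (Nat.not_lt_zero w)

theorem candidate_le_of_witness {i w : ℕ} (hw : ∀ u, W i w u) (s : ℕ) : candidate W i s ≤ w := by
  by_contra h
  obtain ⟨u, -, hu⟩ := candidate_spec i s w (not_le.1 h)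
  exact hu (hw u)

theorem exists_le_candidate {i c : ℕ} (h : ∀ w < c, ∃ u, ¬ W i w u) :
    ∃ s, ∀ t, s ≤ t → c ≤ candidate W i t := by
  classical
  choose! f hf using h
  refine ⟨c + (Finset.range c).sup f, fun t ht => Nat.le_findGreatest (by omega) fun w hw => ?_⟩
  have := Finset.le_sup (f := f) (Finset.mem_range.2 hw)
  exact ⟨f w, by omega, hf w hw⟩

theorem exists_candidate_eq {i : ℕ} (h : Sigma2 W i) :
    ∃ s, ∀ t, s ≤ t → leastWitness W i = candidate W i t + 1 := by
  classical
  obtain ⟨s, hs⟩ := exists_le_candidate (W := W) (i := i) (c := Nat.find h) fun w hw => by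
    simpa using Nat.find_min h hw
  refine ⟨s, fun t ht => ?_⟩
  rw [leastWitness, dif_pos h]
  have := candidate_le_of_witness (Nat.find_spec h) t
  have := hs t ht
  omega

theorem candidate_lt_leastWitness {i : ℕ} (h : Sigma2 W i) (t : ℕ) :
    candidate W i t + 1 ≤ leastWitness W i := by
  classical
  rw [leastWitness, dif_pos h]
  exact Nat.succ_le_succ (candidate_le_of_witness (Nat.find_spec h) t)

theorem exists_hasBit (p : ℕ → Prop) (c : ℕ) :
    ∃ I < 2 ^ c, ∀ i < c, HasBit I i ↔ p i := by
  classical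
  refine ⟨Nat.ofBits (fun i : Fin c => decide (p i)), Nat.ofBits_lt_two_pow _, fun i hi => ?_⟩
  have := Nat.testBit_ofBits_lt (fun i : Fin c => decide (p i)) i hi
  rw [Nat.testBit_eq_decide_div_mod_eq] at this
  simpa [HasBit] using this

/-- Minimality of `u` leaves at most one stage for each pair `(I, c)`, so bounding `c` bounds the
number of stages. -/
theorem guessStage_injOn : Set.InjOn (fun t : ℕ => t.unpair.1) {t | GuessStage W t} := by
  rintro s ⟨-, h1, h2⟩ t ⟨-, h3, h4⟩ hst
  have hst' : s.unpair.1 = t.unpair.1 := hst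
  have hu : s.unpair.2 = t.unpair.2 := by
    rcases lt_trichotomy s.unpair.2 t.unpair.2 with h | h | h
    · exact absurd (hst' ▸ h1) (h4 _ h)
    · exact h
    · exact absurd (hst' ▸ h3) (h2 _ h)
  rw [← Nat.pair_unpair s, hst', hu, Nat.pair_unpair]

theorem isApproximation_guess (W : ℕ → ℕ → ℕ → Prop) :
    IsApproximation (GuessStage W) (guess W) (leastWitness W) := by
  classical
  refine ⟨?_, ?_, ?_, ?_⟩
  · refine ⟨?_, ?_, ?_⟩ <;> simp [Ready]
  · intro s i hsi
    refine if_neg fun h => ?_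
    have h1 := Nat.unpair_left_le s
    have h2 := Nat.unpair_right_le s.unpair.1
    omega
  · intro j
    by_cases hj : Sigma2 W j
    swap
    · have : leastWitness W j = 0 := dif_neg hj
      simp [this]
    obtain ⟨s, hs⟩ := exists_candidate_eq hj
    -- Once the candidate for `j` has settled, a guess below the limit means that `c ≤ j` or that
    -- `j` was wrongly put into `I`. In the latter case readiness keeps `c` at most the candidate,
    -- hence below `leastWitness W j`.
    set C := j + leastWitness W j with hC
    have hsub : {t | GuessStage W t ∧ guess W t j < leastWitness W j} ⊆
        Set.Iio s ∪ {t | GuessStage W t ∧ t.unpair.1.unpair.2 ≤ C} := by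
      rintro t ⟨ht, hlt⟩
      rcases lt_or_ge t s with h | h
      · exact Or.inl h
      refine Or.inr ⟨ht, ?_⟩
      by_contra hc
      by_cases hb : HasBit t.unpair.1.unpair.1 j
      · have h1 := ht.2.1 j (by omega) hb
        have h2 := candidate_lt_leastWitness hj t.unpair.2
        omega
      · rw [guess, if_pos ⟨by omega, hb⟩, hs t h] at hlt
        exact lt_irrefl _ hlt
    refine ((Set.finite_Iio s).union ?_).subset hsub
    refine Set.Finite.of_finite_image (f := fun t : ℕ => t.unpair.1) ?_
      (guessStage_injOn.mono fun t ht => ht.1)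
    refine (Set.finite_Iic (Nat.pair (2 ^ C) C)).subset ?_
    rintro _ ⟨t, ⟨ht, htC⟩, rfl⟩
    dsimp only
    rw [Set.mem_Iic, ← Nat.pair_unpair t.unpair.1]
    exact pair_le_pair (ht.1.le.trans (Nat.pow_le_pow_right (by norm_num) htC)) htC
  · refine Set.infinite_of_forall_exists_gt fun c => ?_
    -- The correct set of false statements eventually becomes ready, and its guess never exceeds the
    -- limit: it is `0` on false statements and an early candidate on true ones.
    obtain ⟨I, hI, hbit⟩ := exists_hasBit (fun i => ¬ Sigma2 W i) (c + 1)
    have hready : ∃ u, Ready W I (c + 1) u := by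
      have : ∀ i, ¬ Sigma2 W i → ∃ s, ∀ t, s ≤ t → c + 1 ≤ candidate W i t := by
        intro i hi
        refine exists_le_candidate fun w _ => ?_
        simp only [Sigma2, not_exists, not_forall] at hi
        exact hi w
      choose! f hf using this
      refine ⟨(Finset.range (c + 1)).sup f, fun i hi hib => hf i ((hbit i hi).1 hib) _ ?_⟩
      exact Finset.le_sup (f := f) (Finset.mem_range.2 hi)
    refine ⟨Nat.pair (Nat.pair I (c + 1)) (Nat.find hready), ⟨⟨?_, ?_, ?_⟩, fun j => ?_⟩, ?_⟩
    · simpa using hI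
    · simpa using Nat.find_spec hready
    · intro u hu
      simp only [Nat.unpair_pair] at hu ⊢
      exact Nat.find_min hready hu
    · rw [guess]
      simp only [Nat.unpair_pair]
      split_ifs with h
      · have hj : Sigma2 W j := by
          by_contra hn
          exact h.2 ((hbit j h.1).2 hn)
        exact candidate_lt_leastWitness hj _
      · exact Nat.zero_le _
    · have h1 := Nat.right_le_pair I (c + 1)
      have h2 := Nat.left_le_pair (Nat.pair I (c + 1)) (Nat.find hready)
      omega

/-- A correct nonzero guess means that the current candidate is the least witness, and candidates
never exceed the stage. -/
theorem exists_witness_le_of_guess_eq {t i : ℕ} (h : guess W t i = leastWitness W i)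
    (hi : Sigma2 W i) : ∃ w ≤ t, ∀ u, W i w u := by
  classical
  rw [leastWitness, dif_pos hi, guess] at h
  split_ifs at h with h1
  refine ⟨Nat.find hi, ?_, Nat.find_spec hi⟩
  have := candidate_le (W := W) i t
  omega

section Computability

variable (hW : PrimrecPred fun p : (ℕ × ℕ) × ℕ => W p.1.1 p.1.2 p.2)
include hW

theorem primrec_candidate : Primrec₂ (candidate W) := by
  refine primrec_findGreatest (α := ℕ × ℕ)
    (p := fun p n => ∀ w < n, ∃ u < p.2 + 1, ¬ W p.1 w u) ?_ Primrec.snd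
  refine primrecPred_forall_lt (α := (ℕ × ℕ) × ℕ)
    (p := fun p w => ∃ u < p.1.2 + 1, ¬ W p.1.1 w u) ?_ Primrec.snd
  refine primrecPred_exists_lt (α := ((ℕ × ℕ) × ℕ) × ℕ)
    (p := fun p u => ¬ W p.1.1.1 p.2 u) ?_
    (Primrec.succ.comp (Primrec.snd.comp (Primrec.fst.comp Primrec.fst)))
  refine PrimrecPred.not (hW.comp (f := fun p : (((ℕ × ℕ) × ℕ) × ℕ) × ℕ =>
    ((p.1.1.1.1, p.1.2), p.2)) ?_)
  exact ((Primrec.fst.comp (Primrec.fst.comp (Primrec.fst.comp Primrec.fst))).pair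
    (Primrec.snd.comp Primrec.fst)).pair Primrec.snd

omit hW in
theorem primrecRel_hasBit : PrimrecRel HasBit :=
  Primrec.eq.comp (Primrec.nat_mod.comp (Primrec.nat_div.comp Primrec.fst
    (primrec_two_pow Primrec.snd)) (Primrec.const 2)) (Primrec.const 1)

theorem primrecPred_ready : PrimrecPred fun p : ℕ × ℕ => Ready W p.1.unpair.1 p.1.unpair.2 p.2 := by
  refine primrecPred_forall_lt (α := ℕ × ℕ)
    (p := fun p i => HasBit p.1.unpair.1 i → p.1.unpair.2 ≤ candidate W i p.2) ?_
    (Primrec.snd.comp (Primrec.unpair.comp Primrec.fst))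
  have h1 : Primrec fun x : (ℕ × ℕ) × ℕ => x.1.1.unpair :=
    Primrec.unpair.comp (Primrec.fst.comp Primrec.fst)
  exact primrecPred_imp (primrecRel_hasBit.comp (Primrec.fst.comp h1) Primrec.snd)
    (Primrec.nat_le.comp (Primrec.snd.comp h1) ((primrec_candidate hW).comp Primrec.snd
      (Primrec.snd.comp Primrec.fst)))

theorem primrecPred_guessStage : PrimrecPred (GuessStage W) := by
  have h1 : Primrec fun t : ℕ => t.unpair.1 := Primrec.fst.comp Primrec.unpair
  have h2 : Primrec fun t : ℕ => t.unpair.2 := Primrec.snd.comp Primrec.unpair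
  have h3 := Primrec.unpair.comp h1
  have hr := primrecPred_ready hW
  refine (Primrec.nat_lt.comp (Primrec.fst.comp h3) (primrec_two_pow (Primrec.snd.comp h3))).and
    ((hr.comp (h1.pair h2)).and ?_)
  refine primrecPred_forall_lt (α := ℕ)
    (p := fun t u => ¬ Ready W t.unpair.1.unpair.1 t.unpair.1.unpair.2 u) ?_ h2
  exact PrimrecPred.not (hr.comp ((h1.comp Primrec.fst).pair Primrec.snd))

theorem primrec_guess : Primrec₂ (guess W) := by
  classical
  have h3 : Primrec fun p : ℕ × ℕ => p.1.unpair.1.unpair :=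
    Primrec.unpair.comp (Primrec.fst.comp (Primrec.unpair.comp Primrec.fst))
  refine (Primrec.ite (c := fun p : ℕ × ℕ => p.2 < p.1.unpair.1.unpair.2 ∧
    ¬ HasBit p.1.unpair.1.unpair.1 p.2) ((Primrec.nat_lt.comp Primrec.snd (Primrec.snd.comp h3)).and
    (primrecRel_hasBit.comp (Primrec.fst.comp h3) Primrec.snd).not)
    (Primrec.succ.comp ((primrec_candidate hW).comp Primrec.snd Primrec.fst))
    (Primrec.const 0)).of_eq fun p => ?_
  rw [guess]

end Computability

end Witness
-- Oracle programs: finite use and substitution of the oracle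
open Filter in
/-- Computations depend continuously on the oracle. -/
theorem OracleCode.eval_eventually {g : ℕ →. ℕ} {G : ℕ → ℕ →. ℕ}
    (h : ∀ n m, m ∈ g n → ∀ᶠ l in atTop, m ∈ G l n) (c : OracleCode) {n m : ℕ}
    (hm : m ∈ c.eval g n) : ∀ᶠ l in atTop, m ∈ c.eval (G l) n := by
  induction c generalizing n m with
  | zero | succ | left | right => exact Eventually.of_forall fun _ => hm
  | oracle => exact h n m hm
  | pair c₁ c₂ h₁ h₂ =>
    simp only [eval, Seq.seq, Part.map_eq_map, Part.mem_bind_iff, Part.mem_map_iff,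
      exists_exists_and_eq_and] at hm ⊢
    obtain ⟨a, ha, b, hb, rfl⟩ := hm
    filter_upwards [h₁ ha, h₂ hb] with l hla hlb
    exact ⟨a, hla, b, hlb, rfl⟩
  | comp c₁ c₂ h₁ h₂ =>
    obtain ⟨a, ha, hb⟩ := Part.mem_bind_iff.1 hm
    filter_upwards [h₂ ha, h₁ hb] with l hla hlb
    exact Part.mem_bind_iff.2 ⟨a, hla, hlb⟩
  | prec c₁ c₂ h₁ h₂ =>
    simp only [eval] at hm ⊢
    generalize n.unpair.2 = k at hm ⊢
    induction k generalizing m with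
    | zero => exact h₁ hm
    | succ k ih =>
      simp only [Part.bind_eq_bind, Part.mem_bind_iff] at hm ⊢
      obtain ⟨a, ha, hb⟩ := hm
      filter_upwards [ih ha, h₂ hb] with l hla hlb
      exact ⟨a, hla, hlb⟩
  | rfind c₁ h₁ =>
    obtain ⟨h0, hlt⟩ := Nat.mem_rfind.1 hm
    obtain ⟨a, ha, ha0⟩ := (Part.mem_map_iff _).1 h0
    have : ∀ᶠ l in atTop, ∀ k ∈ Finset.range m,
        ∃ a, a ∈ c₁.eval (G l) (Nat.pair n k) ∧ decide (a = 0) = false := by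
      rw [Finset.eventually_all]
      intro k hk
      obtain ⟨b, hb, hb0⟩ := (Part.mem_map_iff _).1 (hlt (Finset.mem_range.1 hk))
      filter_upwards [h₁ hb] with l hl using ⟨b, hl, hb0⟩
    filter_upwards [this, h₁ ha] with l hl hla
    exact Nat.mem_rfind.2 ⟨(Part.mem_map_iff _).2 ⟨a, hla, ha0⟩,
      fun {k} hk => (Part.mem_map_iff _).2 (hl k (Finset.mem_range.2 hk))⟩

theorem OracleCode.eval_mono {g g' : ℕ →. ℕ} (h : ∀ n m, m ∈ g n → m ∈ g' n) (c : OracleCode)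
    {n m : ℕ} (hm : m ∈ c.eval g n) : m ∈ c.eval g' n :=
  (eval_eventually (G := fun _ => g') (fun n m hm => .of_forall fun _ => h n m hm) c
    hm).exists.elim fun _ h => h

open Nat.Partrec (Code)

/-- The oracle program with number `e`, with its oracle replaced by the program `c`. -/
def substOracle (c : Code) : ℕ → Code
  | 0 => .zero
  | 1 => .succ
  | 2 => .left
  | 3 => .right
  | 4 => c
  | n + 5 =>
    have h₀ : n / 4 < n + 5 := by omega
    have h₁ : (n / 4).unpair.1 < n + 5 := lt_of_le_of_lt (Nat.unpair_left_le _) h₀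
    have h₂ : (n / 4).unpair.2 < n + 5 := lt_of_le_of_lt (Nat.unpair_right_le _) h₀
    match n % 4 with
    | 0 => .pair (substOracle c (n / 4).unpair.1) (substOracle c (n / 4).unpair.2)
    | 1 => .comp (substOracle c (n / 4).unpair.1) (substOracle c (n / 4).unpair.2)
    | 2 => .prec (substOracle c (n / 4).unpair.1) (substOracle c (n / 4).unpair.2)
    | _ => .comp (.rfind' (substOracle c (n / 4))) (.pair .id .zero)

theorem eval_substOracle (c : Code) (e : ℕ) :
    (substOracle c e).eval = (OracleCode.ofNat e).eval c.eval := by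
  induction e using Nat.strong_induction_on with
  | _ e ih =>
  match e with
  | 0 | 1 | 2 | 3 | 4 => simp [substOracle, OracleCode.ofNat, OracleCode.eval, Code.eval]; try rfl
  | n + 5 =>
    have h₀ : n / 4 < n + 5 := by omega
    have i₀ := ih _ h₀
    have i₁ := ih (n / 4).unpair.1 (lt_of_le_of_lt (Nat.unpair_left_le _) h₀)
    have i₂ := ih (n / 4).unpair.2 (lt_of_le_of_lt (Nat.unpair_right_le _) h₀)
    rw [substOracle, OracleCode.ofNat]
    have hlt : n % 4 < 4 := Nat.mod_lt _ (by norm_num)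
    have hpure : ∀ a, (pure 0 : ℕ →. ℕ) a = Part.some 0 := fun _ => rfl
    interval_cases n % 4
    iterate 3
      · simp only [Code.eval, OracleCode.eval, i₁, i₂]
        rfl
    -- The search of `rfind'` starts at the second component of its input, which the inner pairing
    -- sets to `0`.
    · ext1 a
      simp [Code.eval, OracleCode.eval, i₀, Seq.seq, hpure, Part.map_id']

/-- Course-of-values recursion: the earlier values come as a list whose length is the current
program number. -/
theorem primrec_substOracle : Primrec₂ substOracle := by
  have hlen : Primrec fun p : Code × List Code => p.2.length := Primrec.list_length.comp Primrec.snd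
  have hm : Primrec fun p : Code × List Code => p.2.length - 5 :=
    Primrec.nat_sub.comp hlen (Primrec.const 5)
  have hk : Primrec fun p : Code × List Code => (p.2.length - 5) / 4 :=
    Primrec.nat_div.comp hm (Primrec.const 4)
  have hr : Primrec fun p : Code × List Code => (p.2.length - 5) % 4 :=
    Primrec.nat_mod.comp hm (Primrec.const 4)
  have hget : ∀ {f : Code × List Code → ℕ}, Primrec f →
      Primrec fun p : Code × List Code => p.2.getD (f p) Code.zero := fun hf =>
    (Primrec.list_getD Code.zero).comp Primrec.snd hf
  have ha := hget (Primrec.fst.comp (Primrec.unpair.comp hk))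
  have hb := hget (Primrec.snd.comp (Primrec.unpair.comp hk))
  have hlen_eq : ∀ i, PrimrecPred fun p : Code × List Code => p.2.length = i := fun i =>
    Primrec.eq.comp hlen (Primrec.const i)
  have hr_eq : ∀ i, PrimrecPred fun p : Code × List Code => (p.2.length - 5) % 4 = i := fun i =>
    Primrec.eq.comp hr (Primrec.const i)
  have h := Primrec.option_some.comp <|
    Primrec.ite (hlen_eq 0) (Primrec.const Code.zero) <|
    Primrec.ite (hlen_eq 1) (Primrec.const Code.succ) <|
    Primrec.ite (hlen_eq 2) (Primrec.const Code.left) <|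
    Primrec.ite (hlen_eq 3) (Primrec.const Code.right) <|
    Primrec.ite (hlen_eq 4) Primrec.fst <|
    Primrec.ite (hr_eq 0) (Code.primrec₂_pair.comp ha hb) <|
    Primrec.ite (hr_eq 1) (Code.primrec₂_comp.comp ha hb) <|
    Primrec.ite (hr_eq 2) (Code.primrec₂_prec.comp ha hb) <|
    Code.primrec₂_comp.comp (Code.primrec_rfind'.comp (hget hk))
      (Primrec.const (Code.pair Code.id Code.zero))
  refine Primrec.nat_strong_rec substOracle h.to₂ fun c n => ?_
  simp only [List.length_map, List.length_range, Option.some.injEq]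
  match n with
  | 0 | 1 | 2 | 3 | 4 => simp [substOracle]
  | n + 5 =>
    have h₀ : n / 4 < n + 5 := by omega
    have h₁ : (n / 4).unpair.1 < n + 5 := lt_of_le_of_lt (Nat.unpair_left_le _) h₀
    have h₂ : (n / 4).unpair.2 < n + 5 := lt_of_le_of_lt (Nat.unpair_right_le _) h₀
    have hg : ∀ k < n + 5, ((List.range (n + 5)).map (substOracle c)).getD k Code.zero =
        substOracle c k := fun k hk => by simp [List.getD, hk]
    rw [substOracle]
    simp only [Nat.add_sub_cancel, hg _ h₀, hg _ h₁, hg _ h₂]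
    rw [if_neg (by omega), if_neg (by omega), if_neg (by omega), if_neg (by omega),
      if_neg (by omega)]
    have hlt : n % 4 < 4 := Nat.mod_lt _ (by norm_num)
    interval_cases n % 4 <;> rfl
-- The double jump as a Σ₂ set, and deciding it from witness bounds
section DoubleJump

theorem charFn_congr {A B : Set ℕ} {n : ℕ} (h : n ∈ A ↔ n ∈ B) : charFn A n = charFn B n := by
  by_cases hA : n ∈ A
  · simp [charFn, hA, h.1 hA]
  · simp [charFn, hA, mt h.2 hA]

open Classical in
/-- The oracle answers coded by the finite string `p.1` of length `p.2`. -/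
noncomputable def stringLookup (p : ℕ × ℕ) (n : ℕ) : Option ℕ :=
  if n < p.2 then some (if HasBit p.1 n then 1 else 0) else none

theorem primrec_stringLookup : Primrec₂ stringLookup := by
  classical
  refine (Primrec.ite (c := fun q : (ℕ × ℕ) × ℕ => q.2 < q.1.2)
    (Primrec.nat_lt.comp Primrec.snd (Primrec.snd.comp Primrec.fst))
    (Primrec.option_some.comp (Primrec.ite (c := fun q : (ℕ × ℕ) × ℕ => HasBit q.1.1 q.2)
      (primrecRel_hasBit.comp (Primrec.fst.comp Primrec.fst) Primrec.snd)
      (Primrec.const 1) (Primrec.const 0))) (Primrec.const none)).of_eq fun q => ?_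
  rw [stringLookup]

/-- A single program serves all finite oracles, so that currying yields `stringCode` primitive
recursively in the string. -/
theorem exists_code_stringLookup :
    ∃ c : Code, ∀ p n, c.eval (Nat.pair p n) = (stringLookup p.unpair n : Part ℕ) := by
  have h : Primrec fun q : ℕ => stringLookup q.unpair.1.unpair q.unpair.2 :=
    primrec_stringLookup.comp (Primrec.unpair.comp (Primrec.fst.comp Primrec.unpair))
      (Primrec.snd.comp Primrec.unpair)
  obtain ⟨c, hc⟩ := Code.exists_code.1 (Partrec.nat_iff.1 h.to_comp.ofOption)
  exact ⟨c, fun p n => by simp [hc]⟩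

/-- A program for the oracle coded by a finite string. -/
noncomputable def stringCode (p : ℕ) : Code := Code.curry exists_code_stringLookup.choose p

theorem mem_eval_stringCode {p n m : ℕ} :
    m ∈ (stringCode p).eval n ↔ n < p.unpair.2 ∧ m ∈ charFn {i | HasBit p.unpair.1 i} n := by
  rw [stringCode, Code.eval_curry, exists_code_stringLookup.choose_spec, stringLookup, charFn]
  split_ifs with h <;> simp_all

theorem primrec_stringCode : Primrec stringCode :=
  Code.primrec₂_curry.comp (Primrec.const _) Primrec.id

/-- The program `c` halts on input `n` within `t` steps. -/
def HaltsWithin (c : Code) (n t : ℕ) : Prop := (Code.evaln t c n).isSome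

theorem exists_haltsWithin {c : Code} {n : ℕ} : (∃ t, HaltsWithin c n t) ↔ (c.eval n).Dom := by
  simp only [HaltsWithin, Option.isSome_iff_exists, Part.dom_iff_mem, Code.evaln_complete]
  exact exists_comm

theorem HaltsWithin.mono {c : Code} {n t u : ℕ} (htu : t ≤ u) (h : HaltsWithin c n t) :
    HaltsWithin c n u := by
  obtain ⟨x, hx⟩ := Option.isSome_iff_exists.1 h
  exact Option.isSome_iff_exists.2 ⟨x, Code.evaln_mono htu hx⟩

theorem primrecPred_haltsWithin {α : Type*} [Primcodable α] {c : α → Code} {n t : α → ℕ}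
    (hc : Primrec c) (hn : Primrec n) (ht : Primrec t) :
    PrimrecPred fun a => HaltsWithin (c a) (n a) (t a) := by
  refine (Primrec.eq.comp (Primrec.option_isSome.comp
    (Code.primrec_evaln.comp ((ht.pair hc).pair hn))) (Primrec.const true)).of_eq fun a => ?_
  rfl

theorem mem_jump_empty {i : ℕ} : i ∈ jump ∅ ↔ ∃ t, HaltsWithin (substOracle .zero i) i t := by
  rw [exists_haltsWithin, eval_substOracle, jump, Set.mem_ofPred_eq]
  suffices h : charFn ∅ = Code.zero.eval by rw [h]
  funext n
  simp [charFn, Code.eval]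
  rfl

/-- `w` codes a halting computation of the program `e` from a finite string that consists of answers
to membership in the jump of the empty set, as far as one can see within `u` steps. -/
def DoubleJumpMatrix (e w u : ℕ) : Prop :=
  HaltsWithin (substOracle (stringCode w.unpair.1) e) e w.unpair.2 ∧
    ∀ i < w.unpair.1.unpair.2,
      (HasBit w.unpair.1.unpair.1 i → HaltsWithin (substOracle .zero i) i w.unpair.2) ∧
      (¬ HasBit w.unpair.1.unpair.1 i → ¬ HaltsWithin (substOracle .zero i) i u)

theorem primrecPred_doubleJumpMatrix :
    PrimrecPred fun p : (ℕ × ℕ) × ℕ => DoubleJumpMatrix p.1.1 p.1.2 p.2 := by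
  have he : Primrec fun p : (ℕ × ℕ) × ℕ => p.1.1 := Primrec.fst.comp Primrec.fst
  have hw : Primrec fun p : (ℕ × ℕ) × ℕ => p.1.2.unpair :=
    Primrec.unpair.comp (Primrec.snd.comp Primrec.fst)
  have hw1 : Primrec fun p : (ℕ × ℕ) × ℕ => p.1.2.unpair.1 := Primrec.fst.comp hw
  have hw2 : Primrec fun p : (ℕ × ℕ) × ℕ => p.1.2.unpair.2 := Primrec.snd.comp hw
  have hw11 : Primrec fun p : (ℕ × ℕ) × ℕ => p.1.2.unpair.1.unpair := Primrec.unpair.comp hw1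
  refine (primrecPred_haltsWithin (primrec_substOracle.comp (primrec_stringCode.comp hw1) he)
    he hw2).and ?_
  refine primrecPred_forall_lt (α := (ℕ × ℕ) × ℕ) (p := fun p i =>
    (HasBit p.1.2.unpair.1.unpair.1 i → HaltsWithin (substOracle .zero i) i p.1.2.unpair.2) ∧
      (¬ HasBit p.1.2.unpair.1.unpair.1 i → ¬ HaltsWithin (substOracle .zero i) i p.2))
    ?_ (Primrec.snd.comp hw11)
  have hb : PrimrecPred fun q : ((ℕ × ℕ) × ℕ) × ℕ => HasBit q.1.1.2.unpair.1.unpair.1 q.2 :=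
    primrecRel_hasBit.comp (Primrec.fst.comp (hw11.comp Primrec.fst)) Primrec.snd
  have hs : Primrec fun q : ((ℕ × ℕ) × ℕ) × ℕ => substOracle .zero q.2 :=
    primrec_substOracle.comp (Primrec.const _) Primrec.snd
  exact (primrecPred_imp hb (primrecPred_haltsWithin hs Primrec.snd (hw2.comp Primrec.fst))).and
    (primrecPred_imp hb.not (primrecPred_haltsWithin hs Primrec.snd
      (Primrec.snd.comp Primrec.fst)).not)

open Filter in
theorem mem_zeroDoubleJump {e : ℕ} :
    e ∈ zeroDoubleJump ↔ ∃ w, ∀ u, DoubleJumpMatrix e w u := by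
  constructor
  · intro he
    obtain ⟨m, hm⟩ := Part.dom_iff_mem.1 he
    -- A halting computation uses only the oracle below some `l`. The witness consists of a string
    -- of correct answers below `l` and a time by which the computation and all positive answers
    -- have been verified.
    have hlim := OracleCode.eval_eventually (g := charFn (jump ∅))
      (G := fun l n => if n < l then charFn (jump ∅) n else Part.none) (fun n m hm => by
        filter_upwards [eventually_gt_atTop n] with l hl
        rwa [if_pos hl]) _ hm
    obtain ⟨l, hl⟩ := hlim.exists
    obtain ⟨σ, -, hσ⟩ := exists_hasBit (fun i => i ∈ jump ∅) l
    have hdom : ((substOracle (stringCode (Nat.pair σ l)) e).eval e).Dom := by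
      rw [eval_substOracle]
      refine Part.dom_iff_mem.2 ⟨m, OracleCode.eval_mono (fun n k hk => ?_) _ hl⟩
      rw [mem_eval_stringCode]
      split_ifs at hk with hn
      · refine ⟨by simpa using hn, ?_⟩
        rwa [charFn_congr (B := jump ∅) (by simpa using hσ n hn)]
      · exact absurd hk (Part.notMem_none _)
    have hhalt : ∀ i ∈ Finset.range l, ∀ᶠ t in atTop,
        i ∈ jump ∅ → HaltsWithin (substOracle .zero i) i t := by
      intro i _
      by_cases hi : i ∈ jump ∅
      · obtain ⟨t, ht⟩ := mem_jump_empty.1 hi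
        filter_upwards [eventually_ge_atTop t] with u hu _ using ht.mono hu
      · exact .of_forall fun t h => absurd h hi
    obtain ⟨t₀, ht₀⟩ := exists_haltsWithin.2 hdom
    obtain ⟨t, ht, ht₀t⟩ := (((Finset.eventually_all _).2 hhalt).and
      (eventually_ge_atTop t₀)).exists
    refine ⟨Nat.pair (Nat.pair σ l) t, fun u => ?_⟩
    simp only [DoubleJumpMatrix, Nat.unpair_pair]
    refine ⟨ht₀.mono ht₀t, fun i hi => ⟨fun h => ht i (Finset.mem_range.2 hi) ((hσ i hi).1 h),
      fun h hu => h ((hσ i hi).2 (mem_jump_empty.2 ⟨u, hu⟩))⟩⟩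
  -- Positive answers are verified outright, and negative ones are never contradicted because the
  -- matrix holds for all `u`; so the string is a true initial segment of `0'`.
  · rintro ⟨w, hw⟩
    have hdom := exists_haltsWithin.1 ⟨_, (hw 0).1⟩
    rw [eval_substOracle] at hdom
    obtain ⟨m, hm⟩ := Part.dom_iff_mem.1 hdom
    refine Part.dom_iff_mem.2 ⟨m, OracleCode.eval_mono (fun n k hk => ?_) _ hm⟩
    obtain ⟨hn, hk⟩ := mem_eval_stringCode.1 hk
    have : n ∈ jump ∅ ↔ HasBit w.unpair.1.unpair.1 n := by
      refine ⟨fun h => ?_, fun h => mem_jump_empty.2 ⟨_, ((hw 0).2 n hn).1 h⟩⟩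
      obtain ⟨u, hu⟩ := mem_jump_empty.1 h
      by_contra hb
      exact ((hw u).2 n hn).2 hb hu
    rwa [charFn_congr (B := {i | HasBit w.unpair.1.unpair.1 i}) (by simpa using this)]

/-- The `Σ₂` statements whose witnesses compute the double jump: the even ones state that `e` lies
in the double jump, the odd ones that none of the numbers up to `M` is a witness for that. -/
def doubleJumpWitness (i w u : ℕ) : Prop :=
  (i % 2 = 0 ∧ DoubleJumpMatrix (i / 2) w u) ∨
    (i % 2 = 1 ∧ ∀ w' < (i / 2).unpair.2 + 1, ∃ u' < w + 1,
      ¬ DoubleJumpMatrix (i / 2).unpair.1 w' u')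

theorem primrecPred_doubleJumpWitness :
    PrimrecPred fun p : (ℕ × ℕ) × ℕ => doubleJumpWitness p.1.1 p.1.2 p.2 := by
  have hi : Primrec fun p : (ℕ × ℕ) × ℕ => p.1.1 := Primrec.fst.comp Primrec.fst
  have hmod : Primrec fun p : (ℕ × ℕ) × ℕ => p.1.1 % 2 :=
    Primrec.nat_mod.comp hi (Primrec.const 2)
  have hdiv : Primrec fun p : (ℕ × ℕ) × ℕ => p.1.1 / 2 := primrec_half.comp hi
  have hQ := primrecPred_doubleJumpMatrix
  refine PrimrecPred.or ((Primrec.eq.comp hmod (Primrec.const 0)).and (hQ.comp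
    ((hdiv.pair (Primrec.snd.comp Primrec.fst)).pair Primrec.snd)))
    ((Primrec.eq.comp hmod (Primrec.const 1)).and ?_)
  refine primrecPred_forall_lt (α := (ℕ × ℕ) × ℕ) (p := fun p w' => ∃ u' < p.1.2 + 1,
      ¬ DoubleJumpMatrix (p.1.1 / 2).unpair.1 w' u') ?_
      (Primrec.succ.comp (Primrec.snd.comp (Primrec.unpair.comp hdiv)))
  refine primrecPred_exists_lt (α := ((ℕ × ℕ) × ℕ) × ℕ) (p := fun q u' =>
      ¬ DoubleJumpMatrix (q.1.1.1 / 2).unpair.1 q.2 u') ?_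
      (Primrec.succ.comp (Primrec.snd.comp (Primrec.fst.comp Primrec.fst)))
  refine PrimrecPred.not (hQ.comp (f := fun q : (((ℕ × ℕ) × ℕ) × ℕ) × ℕ =>
    (((q.1.1.1.1 / 2).unpair.1, q.1.2), q.2)) ?_)
  exact ((Primrec.fst.comp (Primrec.unpair.comp (hdiv.comp (Primrec.fst.comp Primrec.fst)))).pair
    (Primrec.snd.comp Primrec.fst)).pair Primrec.snd

/-- The value `M = g (2 * e)` confines the witness. If `e` is not in `0''`, every candidate up to
`M` is refuted by some common time, which is a true odd statement; its bound says how long to wait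
for the refutations. -/
theorem mem_zeroDoubleJump_iff_of_bound {g : ℕ → ℕ}
    (hg : ∀ i, Sigma2 doubleJumpWitness i → ∃ w ≤ g i, ∀ u, doubleJumpWitness i w u) (e : ℕ) :
    e ∈ zeroDoubleJump ↔ ∃ w < g (2 * e) + 1,
      ∀ u < g (2 * Nat.pair e (g (2 * e)) + 1) + 1, DoubleJumpMatrix e w u := by
  have heven : ∀ w u, doubleJumpWitness (2 * e) w u ↔ DoubleJumpMatrix e w u := by
    intro w u
    simp [doubleJumpWitness]
  constructor
  · intro he
    obtain ⟨w, hw⟩ := mem_zeroDoubleJump.1 he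
    obtain ⟨w', hle, hw'⟩ := hg (2 * e) ⟨w, fun u => (heven w u).2 (hw u)⟩
    exact ⟨w', Nat.lt_succ_of_le hle, fun u _ => (heven w' u).1 (hw' u)⟩
  · rintro ⟨w, hw, hwu⟩
    by_contra he
    simp only [mem_zeroDoubleJump, not_exists, not_forall] at he
    set M := g (2 * e)
    have hodd : ∀ v u, doubleJumpWitness (2 * Nat.pair e M + 1) v u ↔
        ∀ w' < M + 1, ∃ u' < v + 1, ¬ DoubleJumpMatrix e w' u' := by
      intro v u
      have h1 : (2 * Nat.pair e M + 1) / 2 = Nat.pair e M := by omega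
      have h2 : (2 * Nat.pair e M + 1) % 2 = 1 := by omega
      simp only [doubleJumpWitness, h1, h2, Nat.unpair_pair]
      simp
    choose b hb using he
    have hs : Sigma2 doubleJumpWitness (2 * Nat.pair e M + 1) := by
      refine ⟨(Finset.range (M + 1)).sup b, fun u => (hodd _ u).2 fun w' hw' => ?_⟩
      exact ⟨b w', Nat.lt_succ_of_le (Finset.le_sup (f := b) (Finset.mem_range.2 hw')), hb w'⟩
    obtain ⟨v, hv, hvu⟩ := hg _ hs
    obtain ⟨u', hu', hn⟩ := (hodd v 0).1 (hvu 0) w hw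
    exact hn (hwu u' (by omega))

/-- A bound for the witnesses computes the double jump. -/
theorem recursiveIn_zeroDoubleJump {O : Set (ℕ →. ℕ)} {g : ℕ → ℕ}
    (hgO : Nat.RecursiveIn O fun n => Part.some (g n))
    (hg : ∀ i, Sigma2 doubleJumpWitness i → ∃ w ≤ g i, ∀ u, doubleJumpWitness i w u) :
    Nat.RecursiveIn O (charFn zeroDoubleJump) := by
  classical
  have hp : PrimrecPred fun q : (ℕ × ℕ) × ℕ => ∃ w < q.1.2 + 1, ∀ u < q.2 + 1,
      DoubleJumpMatrix q.1.1 w u := by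
    refine primrecPred_exists_lt (α := (ℕ × ℕ) × ℕ) (p := fun q w => ∀ u < q.2 + 1,
      DoubleJumpMatrix q.1.1 w u) ?_ (Primrec.succ.comp (Primrec.snd.comp Primrec.fst))
    refine primrecPred_forall_lt (α := ((ℕ × ℕ) × ℕ) × ℕ) (p := fun q u =>
      DoubleJumpMatrix q.1.1.1 q.2 u) ?_ (Primrec.succ.comp (Primrec.snd.comp Primrec.fst))
    refine primrecPred_doubleJumpMatrix.comp (f := fun q : (((ℕ × ℕ) × ℕ) × ℕ) × ℕ =>
      ((q.1.1.1.1, q.1.2), q.2)) ?_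
    exact ((Primrec.fst.comp (Primrec.fst.comp (Primrec.fst.comp Primrec.fst))).pair
      (Primrec.snd.comp Primrec.fst)).pair Primrec.snd
  have hF : Nat.Primrec fun x : ℕ => if ∃ w < x.unpair.1.unpair.2 + 1, ∀ u < x.unpair.2 + 1,
      DoubleJumpMatrix x.unpair.1.unpair.1 w u then 1 else 0 := by
    refine Primrec.nat_iff.1 (Primrec.ite (hp.comp (f := fun x : ℕ =>
      (x.unpair.1.unpair, x.unpair.2)) ?_) (Primrec.const 1) (Primrec.const 0))
    exact (Primrec.unpair.comp (Primrec.fst.comp Primrec.unpair)).pair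
      (Primrec.snd.comp Primrec.unpair)
  have hid : Nat.RecursiveIn O fun n => Part.some n :=
    Nat.Primrec.recursiveIn (f := fun n => n) (Primrec.nat_iff.1 Primrec.id)
  have h1 : Nat.RecursiveIn O fun e => Part.some (Nat.pair e (g (2 * e))) := by
    refine (hid.pair (hgO.comp (Nat.Primrec.recursiveIn (f := fun n => 2 * n)
      (Primrec.nat_iff.1 Primrec.nat_double)))).of_eq fun e => ?_
    simp [Seq.seq]
  have h2 : Nat.RecursiveIn O fun e => Part.some
      (Nat.pair (Nat.pair e (g (2 * e))) (g (2 * Nat.pair e (g (2 * e)) + 1))) := by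
    refine (h1.pair (hgO.comp ((Nat.Primrec.recursiveIn (f := fun n => 2 * n + 1)
      (Primrec.nat_iff.1 Primrec.nat_double_succ)).comp h1))).of_eq fun e => ?_
    simp [Seq.seq]
  refine ((Nat.Primrec.recursiveIn hF).comp h2).of_eq fun e => ?_
  simp [charFn, mem_zeroDoubleJump_iff_of_bound hg e]

end DoubleJump
-- Computing the bound from a self-embedding
theorem recursiveIn_iterate {S : Set ℕ} (f : S → S) (x : S) :
    Nat.RecursiveIn {toPFun f} fun n => Part.some (f^[n] x : ℕ) := by
  have hconst : Nat.RecursiveIn {toPFun f} fun _ => Part.some (x : ℕ) :=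
    Nat.Primrec.recursiveIn (f := fun _ => (x : ℕ)) (Nat.Primrec.const _)
  have hid : Nat.RecursiveIn {toPFun f} fun n => Part.some n :=
    Nat.Primrec.recursiveIn (f := fun n => n) (Primrec.nat_iff.1 Primrec.id)
  have hstep : Nat.RecursiveIn {toPFun f} fun p => toPFun f p.unpair.2.unpair.2 := by
    refine ((Nat.RecursiveIn.oracle (toPFun f) (Set.mem_singleton _)).comp
      (Nat.RecursiveIn.right.comp Nat.RecursiveIn.right)).of_eq fun p => ?_
    exact (congrArg (fun q => Part.bind q (toPFun f)) (Part.bind_some _ _)).trans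
      (Part.bind_some _ _)
  refine ((hconst.prec hstep).comp (hid.pair hid)).of_eq_tot (g := fun n => (f^[n] x : ℕ))
    fun n => ?_
  refine Part.mem_bind_iff.2 ⟨Nat.pair n n, by simp [Seq.seq], ?_⟩
  simp only [Nat.unpair_pair, Part.bind_eq_bind]
  generalize n = k
  induction k with
  | zero => exact Part.mem_some _
  | succ k ih =>
    refine Part.mem_bind_iff.2 ⟨_, ih, ?_⟩
    rw [Function.iterate_succ_apply']
    -- The oracle is partial with domain `S`; it answers here because the iterates stay in `S`.
    exact ⟨(f^[k] x).2, rfl⟩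

theorem BinTree.isTreeOrder {N : ℕ → Prop} {R : ℕ → ℕ → Prop} (H : IsNumTree N R) :
    IsTreeOrder (fun a b : BinTree N R => a ≤ b) where
  partialOrder := inferInstance
  exists_root := exists_root H
  finite_below := finite_Iic
  chain_below n a ha b hb _ := le_linear a b n ha hb

theorem BinTree.isBinaryBranching {N : ℕ → Prop} {R : ℕ → ℕ → Prop} (H : IsNumTree N R) :
    IsBinaryBranching (fun a b : BinTree N R => a ≤ b) := by
  intro n
  simp only [isSuccessor_iff_covBy]
  exact encard_covBy_le_two H n

/-- Every self-embedding of the binary tree of an approximation that is not onto computes a function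
bounding stages that agree with the limit. -/
theorem IsApproximation.exists_recursiveIn_bound {V : ℕ → Prop} {Y : ℕ → ℕ → ℕ} {m : ℕ → ℕ}
    (A : IsApproximation V Y m)
    (δ : binLE (StageNode V) (StageRel V Y) ↪r binLE (StageNode V) (StageRel V Y))
    (hδ : ¬ Function.Surjective δ) :
    ∃ g : ℕ → ℕ, (Nat.RecursiveIn {toPFun δ} fun n => Part.some (g n)) ∧
      ∀ k, ∃ u ≤ g k, ∀ i ≤ k, Y u i = m i := by
  have := A.isCore.infinite_binTree A.isNumTree
  obtain ⟨L, x, z, h⟩ := exists_increasing_sequence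
    (T := BinTree (StageNode V) (StageRel V Y)) BinTree.finite_Iic BinTree.le_linear
    (BinTree.exists_root A.isNumTree) (BinTree.encard_covBy_le_two A.isNumTree)
    (A.isCore.binTree_split A.isNumTree) (f := δ) (fun _ _ => δ.map_rel_iff) hδ
  -- `L` and `x` are fixed parameters that need not be found effectively; the value is obtained by
  -- iterating `δ` from `x` exactly `L * (2 ^ k + 1)` times.
  refine ⟨fun k => BinTree.code (R := StageRel V Y) ((δ^[L])^[2 ^ k + 1] x), ?_, ?_⟩
  · have hp : Nat.Primrec fun k => L * (2 ^ k + 1) := Primrec.nat_iff.1 <|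
      Primrec.nat_mul.comp (Primrec.const L) (Primrec.succ.comp (primrec_two_pow Primrec.id))
    refine ((recursiveIn_iterate δ x).comp (Nat.Primrec.recursiveIn hp)).of_eq fun k => ?_
    refine (Part.bind_some _ _).trans (congrArg
      (fun f : BinNode (StageNode V) → BinNode (StageNode V) => Part.some (f x : ℕ)) ?_)
    exact Function.iterate_mul δ L (2 ^ k + 1)
  · exact fun k => A.exists_agreeing_stage (x := fun n => (δ^[L])^[n] x) (z := z)
      (fun i => (h i).1) (fun i => (h i).2.2.1) (fun i => (h i).2.1)
      (fun i => (h i).2.2.2.1) (fun i => (h i).2.2.2.2) k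

end SelfEmb

theorem theorem5p1 :
    ∃ (S : Set ℕ) (le : S → S → Prop),
      SelfEmb.IsTreeOrder le ∧ SelfEmb.IsComputablePresentation S le ∧
      SelfEmb.IsBinaryBranching le ∧ SelfEmb.IsType3 le ∧
      ∀ δ : le ↪r le, ¬ Function.Surjective δ →
        TuringReducible (SelfEmb.charFn SelfEmb.zeroDoubleJump) (SelfEmb.toPFun δ) := by
  have A := SelfEmb.isApproximation_guess SelfEmb.doubleJumpWitness
  have hV := SelfEmb.primrecPred_guessStage SelfEmb.primrecPred_doubleJumpWitness
  have hY := SelfEmb.primrec_guess SelfEmb.primrecPred_doubleJumpWitness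
  have := A.isCore.infinite_binTree A.isNumTree
  refine ⟨_, SelfEmb.binLE _ _, SelfEmb.BinTree.isTreeOrder A.isNumTree,
    SelfEmb.isComputablePresentation (SelfEmb.primrecPred_stageNode hV)
      (SelfEmb.primrecRel_stageRel hV hY A.support),
    SelfEmb.BinTree.isBinaryBranching A.isNumTree,
    SelfEmb.isType3_of_split SelfEmb.BinTree.finite_Iic SelfEmb.BinTree.le_linear
      (A.isCore.binTree_split A.isNumTree), fun δ hδ => ?_⟩
  obtain ⟨g, hg, hbound⟩ := A.exists_recursiveIn_bound δ hδ
  refine RecursiveIn.iff_nat.2 (SelfEmb.recursiveIn_zeroDoubleJump hg fun i hi => ?_)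
  -- Only the coordinate `i` of the agreement up to `i` is used to bound the witness of statement
  -- `i`.
  obtain ⟨u, hu, hui⟩ := hbound i
  obtain ⟨w, hw, hwu⟩ := SelfEmb.exists_witness_le_of_guess_eq (hui i le_rfl) hi
  exact ⟨w, hw.trans hu, hwu⟩
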